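/- Let $A$ be a finite alphabet and let $A^{\mathbb N^+}$ be the set of sequences $\omega=\omega_1\omega_2\cdots$ over $A$ with the shift $\sigma(\omega_1\omega_2\cdots)=\omega_2\omega_3\cdots$ and the metric $d(\omega,\gamma)=e^{-\min\{k\ge 1:\ \omega_k\ne\gamma_k\}}$ for $\omega\neq\gamma$, $d(\omega,\omega)=0$. Let $X\subseteq A^{\mathbb N^+}$ be a one-sided subshift (a closed set with $\sigma(X)\subseteq X$) and $f=\sigma|_X$. Assume that there are a non-empty compact set $Y\subseteq X$ and a positive integer $N$ such that $f^N(Y)=Y$, $X=\bigcup_{l=0}^{N-1}f^l(Y)$ and $(Y,g)$, $g:=f^N|_Y$, has the non-uniform specification property, that is: for every $\varepsilon>0$ there are positive integers $p(n,\varepsilon)$, $n\ge1$, with $\limsup_{n\to\infty}p(n,\varepsilon)/n=0$ such that for all $k\geq 1$, all $x_1,\dots,x_k\in Y$, all positive integers $n_1,\dots,n_k$ and all $p_i\ge p(n_i,\varepsilon)$ there is $y\in Y$ with $d\big(g^{\,n_1+p_1+\cdots+n_{i-1}+p_{i-1}+t}(y),\,g^{t}(x_i)\big)<\varepsilon$ for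 all $1\le i\le k$ and $0\le t<n_i$. For each $j\ge1$ let $\varphi_j:\mathbb N\to(0,1]$ be a function, $\mathcal Z_j=\{z_j^n\}_{n\ge0}\subset X$ a sequence of points, and $S_j=\{s_j^i\}_{i\ge0}\subset\mathbb N$ a sequence with $\lim_{i\to\infty}s_j^i=\infty$. Put $$\mathfrak S_j=\{x\in X:\ d(f^n(x),z_j^n)<\varphi_j(n)\text{ for infinitely many }n\in S_j\},\qquad \mathfrak S=\bigcap_{j\geq 1}\mathfrak S_j,$$ $$\overline\tau=\sup_{j\ge1}\limsup_{n\to\infty}-\frac{\ln\varphi_j(n)}{n},\qquad \underline\tau=\sup_{j\ge1}\liminf_{n\to\infty}-\frac{\ln\varphi_j(n)}{n}$$ (elements of $[0,\infty]$, with $\frac1{1+\infty}=0$), and let $$\mathrm{Ind}'_j=\{I_1-I_2:\ I_1,I_2\in\{0,\dots,N-1\},\ z_j^{s_j^i}\in f^{I_1}(Y)\text{ and }N\mid s_j^i-I_2\text{ for infinitely many }i\}\subset\mathbb Z .$$ Let $h_{top}(f,X)$ denote the topological entropy of $f$, let $h_{top}(f,Z)$, for $Z\subseteq X$, denote Bowen's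 topological entropy of $f$ on the subset $Z$, that is, $\lim_{\varepsilon\to0}\inf\{s\ge0:\lim_{m\to\infty}\inf\sum_i e^{-sn_i}=0\}$, the inner infimum being over the finite or countable covers of $Z$ by sets $\{y\in X: d(f^t(x_i),f^t(y))<\varepsilon,\ 0\le t<n_i\}$ with $x_i\in X$, $n_i\ge m$. Let $\dim_H$ denote Hausdorff dimension with respect to $d$. If $\bigcap_{j\ge1}\mathrm{Ind}'_j\ne\emptyset$, then $\mathfrak S$ is non-empty, $$\frac1{1+\overline\tau}h_{top}(f,X)\le h_{top}(f,\mathfrak S)\le\frac1{1+\underline\tau}h_{top}(f,X),$$ $$\frac1{1+\overline\tau}h_{top}(f,X)\le \dim_H\mathfrak S\le\frac1{1+\underline\tau}h_{top}(f,X).$$ If moreover $Y=X$, $N=1$ and $S_j=\mathbb N$ for every $j\ge1$, then $$h_{top}(f,\mathfrak S)=\dim_H\mathfrak S=\frac1{1+\underline\tau}h_{top}(f,X).$$ -/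

import Mathlib

open Set Filter Topology
open scoped ENNReal NNReal

namespace ShrinkingTarget

section Metric

/-! ### The metric on the one-sided full shift

A point `ω₁ω₂⋯` of the one-sided full shift over the alphabet `A` is a function `ω : ℕ → A`, the
symbol `ωₖ` (`k ≥ 1`) being `ω (k - 1)`. -/

/-- `d(ω, γ) = exp (-min {k ≥ 1 : ωₖ ≠ γₖ})` for `ω ≠ γ`, and `d(ω, ω) = 0`. In the indexing from
`0`, the first `k ≥ 1` with `ωₖ ≠ γₖ` is `PiNat.firstDiff ω γ + 1`. -/
noncomputable def shiftDist {A : Type*} (ω γ : ℕ → A) : ℝ :=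
  open scoped Classical in
  if ω = γ then 0 else Real.exp (-((PiNat.firstDiff (E := fun _ => A) ω γ : ℝ) + 1))

theorem shiftDist_self {A : Type*} (ω : ℕ → A) : shiftDist ω ω = 0 := by
  simp [shiftDist]

theorem shiftDist_of_ne {A : Type*} {ω γ : ℕ → A} (h : ω ≠ γ) :
    shiftDist ω γ = Real.exp (-((PiNat.firstDiff (E := fun _ => A) ω γ : ℝ) + 1)) := by
  simp [shiftDist, h]

theorem shiftDist_nonneg {A : Type*} (ω γ : ℕ → A) : 0 ≤ shiftDist ω γ := by
  unfold shiftDist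
  split_ifs
  · exact le_rfl
  · positivity

theorem shiftDist_comm {A : Type*} (ω γ : ℕ → A) : shiftDist ω γ = shiftDist γ ω := by
  by_cases h : ω = γ
  · rw [h]
  · rw [shiftDist_of_ne h, shiftDist_of_ne (Ne.symm h), PiNat.firstDiff_comm]

theorem eq_of_shiftDist_eq_zero {A : Type*} (ω γ : ℕ → A) (h : shiftDist ω γ = 0) : ω = γ := by
  by_contra hne
  rw [shiftDist_of_ne hne] at h
  exact (Real.exp_pos _).ne' h

theorem shiftDist_triangle {A : Type*} (ω γ ξ : ℕ → A) :
    shiftDist ω ξ ≤ shiftDist ω γ + shiftDist γ ξ := by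
  by_cases h1 : ω = γ
  · rw [h1, shiftDist_self, zero_add]
  by_cases h2 : γ = ξ
  · rw [h2, shiftDist_self, add_zero]
  by_cases h3 : ω = ξ
  · rw [h3, shiftDist_self]
    exact add_nonneg (shiftDist_nonneg _ _) (shiftDist_nonneg _ _)
  have hmin := PiNat.min_firstDiff_le (E := fun _ => A) ω γ ξ h3
  rcases min_le_iff.1 hmin with h | h
  · have : shiftDist ω ξ ≤ shiftDist ω γ := by
      rw [shiftDist_of_ne h3, shiftDist_of_ne h1, Real.exp_le_exp]
      have : (PiNat.firstDiff (E := fun _ => A) ω γ : ℝ) ≤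
        PiNat.firstDiff (E := fun _ => A) ω ξ := by exact_mod_cast h
      linarith
    linarith [shiftDist_nonneg γ ξ]
  · have : shiftDist ω ξ ≤ shiftDist γ ξ := by
      rw [shiftDist_of_ne h3, shiftDist_of_ne h2, Real.exp_le_exp]
      have : (PiNat.firstDiff (E := fun _ => A) γ ξ : ℝ) ≤
        PiNat.firstDiff (E := fun _ => A) ω ξ := by exact_mod_cast h
      linarith
    linarith [shiftDist_nonneg ω γ]

theorem shiftDist_lt_iff {A : Type*} (ω γ : ℕ → A) (n : ℕ) :
    shiftDist ω γ < Real.exp (-(n : ℝ)) ↔ γ ∈ PiNat.cylinder (E := fun _ => A) ω n := by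
  by_cases h : ω = γ
  · subst h
    simp [shiftDist_self, Real.exp_pos]
  · rw [PiNat.mem_cylinder_comm, PiNat.mem_cylinder_iff_le_firstDiff h, shiftDist_of_ne h,
      Real.exp_lt_exp]
    constructor
    · intro h'
      have : (n : ℝ) < PiNat.firstDiff (E := fun _ => A) ω γ + 1 := by linarith
      have : n < PiNat.firstDiff (E := fun _ => A) ω γ + 1 := by exact_mod_cast this
      omega
    · intro h'
      have : (n : ℝ) ≤ PiNat.firstDiff (E := fun _ => A) ω γ := by exact_mod_cast h'
      linarith

/-- The metric `shiftDist` induces the product of the discrete topologies. -/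
theorem isOpen_iff_shiftDist {A : Type*} [TopologicalSpace A] [DiscreteTopology A]
    (s : Set (ℕ → A)) :
    IsOpen s ↔ ∀ ω ∈ s, ∃ ε > 0, ∀ γ, shiftDist ω γ < ε → γ ∈ s := by
  constructor
  · intro hs ω hω
    obtain ⟨v, ⟨γ, n, rfl⟩, h2, h3⟩ :=
      (PiNat.isTopologicalBasis_cylinders (fun _ : ℕ => A)).exists_subset_of_mem_open hω hs
    rw [← PiNat.mem_cylinder_iff_eq.1 h2] at h3
    exact ⟨Real.exp (-(n : ℝ)), Real.exp_pos _, fun ξ hξ => h3 ((shiftDist_lt_iff ω ξ n).1 hξ)⟩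
  · intro h
    refine (PiNat.isTopologicalBasis_cylinders (fun _ : ℕ => A)).isOpen_iff.2 ?_
    intro ω hω
    obtain ⟨ε, εpos, hε⟩ := h ω hω
    have ht : Tendsto (fun n : ℕ => Real.exp (-(n : ℝ))) atTop (𝓝 0) :=
      Real.tendsto_exp_neg_atTop_nhds_zero.comp tendsto_natCast_atTop_atTop
    obtain ⟨n, hn⟩ := ((tendsto_order.1 ht).2 ε εpos).exists
    exact ⟨PiNat.cylinder ω n, ⟨ω, n, rfl⟩, PiNat.self_mem_cylinder ω n,
      fun γ hγ => hε γ (((shiftDist_lt_iff ω γ n).2 hγ).trans hn)⟩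

/-- The one-sided full shift `ℕ → A` over a discrete alphabet as a metric space. -/
noncomputable instance shiftMetricSpace {A : Type*} [TopologicalSpace A] [DiscreteTopology A] :
    MetricSpace (ℕ → A) :=
  MetricSpace.ofDistTopology shiftDist shiftDist_self shiftDist_comm shiftDist_triangle
    isOpen_iff_shiftDist eq_of_shiftDist_eq_zero

/-- The shift action `ω₁ω₂⋯ ↦ ω₂ω₃⋯` on the points of a one-sided subshift. -/
def subshiftMap {A : Type*} [TopologicalSpace A]
    (X : SymbolicDynamics.FullShift.Subshift A ℕ) : X.carrier → X.carrier :=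
  (X.mapsTo 1).restrict (SymbolicDynamics.FullShift.shift 1) X.carrier X.carrier

end Metric

section Dynamics

/-! ### Entropy, specification and shrinking targets for a map `f` of a metric space -/

/-- The dynamical ball `B_n(x, ε, f) = {y : d(fⁱ x, fⁱ y) < ε for all 0 ≤ i < n}`. -/
def dynBall {M : Type*} [MetricSpace M] (f : M → M) (n : ℕ) (x : M) (ε : ℝ) : Set M :=
  {y | ∀ i < n, dist (f^[i] x) (f^[i] y) < ε}

/-- `E` is `(n, ε)`-separated: distinct points of `E` are at distance `> ε` at some time `< n`. -/
def IsDynSeparated {M : Type*} [MetricSpace M] (f : M → M) (n : ℕ) (ε : ℝ) (E : Set M) : Prop :=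
  ∀ x ∈ E, ∀ y ∈ E, x ≠ y → ∃ k < n, ε < dist (f^[k] x) (f^[k] y)

/-- The maximal cardinality `s(M, n, ε)` of an `(n, ε)`-separated set. -/
noncomputable def maxSeparated {M : Type*} [MetricSpace M] (f : M → M) (n : ℕ) (ε : ℝ) : ℕ∞ :=
  ⨆ (E : Set M) (_ : IsDynSeparated f n ε E), E.encard

/-- The topological entropy `lim_{ε → 0} limsup_{n → ∞} (ln s(M, n, ε)) / n` of `f` on the whole
space; the limit over `ε` is monotone, hence a supremum. -/
noncomputable def topEntropy {M : Type*} [MetricSpace M] (f : M → M) : ℝ≥0∞ :=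
  ⨆ (ε : ℝ) (_ : 0 < ε),
    (limsup (fun n : ℕ => ENNReal.log (maxSeparated f n ε : ℝ≥0∞) / ((n : ℝ) : EReal))
      atTop).toENNReal

/-- `M^s_{N, ε}(Z)`: the infimum of `∑ exp (-s nᵢ)` over the countable families of dynamical balls
`B_{nᵢ}(xᵢ, ε, f)` with `nᵢ ≥ N` that cover `Z`. A pair `(x, n)` stands for `B_n(x, ε, f)`. -/
noncomputable def bowenPremeasure {M : Type*} [MetricSpace M] (f : M → M) (Z : Set M) (ε : ℝ)
    (s : ℝ≥0) (N : ℕ) : ℝ≥0∞ :=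
  ⨅ (C : Set (M × ℕ)) (_ : C.Countable) (_ : ∀ b ∈ C, N ≤ b.2)
    (_ : Z ⊆ ⋃ b ∈ C, dynBall f b.2 b.1 ε),
    ∑' b : C, ENNReal.ofReal (Real.exp (-((s : ℝ) * ((b : M × ℕ).2 : ℝ))))

/-- `M^s_ε(Z) = lim_{N → ∞} M^s_{N, ε}(Z)`, a monotone limit. -/
noncomputable def bowenMeasure {M : Type*} [MetricSpace M] (f : M → M) (Z : Set M) (ε : ℝ)
    (s : ℝ≥0) : ℝ≥0∞ :=
  ⨆ N : ℕ, bowenPremeasure f Z ε s N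

/-- Bowen's topological entropy of `f` on an arbitrary subset `Z`: the limit as `ε → 0`
(a supremum, by monotonicity) of `inf {s ≥ 0 : M^s_ε(Z) = 0}`. -/
noncomputable def bowenEntropy {M : Type*} [MetricSpace M] (f : M → M) (Z : Set M) : ℝ≥0∞ :=
  ⨆ (ε : ℝ) (_ : 0 < ε), ⨅ (s : ℝ≥0) (_ : bowenMeasure f Z ε s = 0), (s : ℝ≥0∞)

/-- The non-uniform specification property (at every scale `ε > 0`) of the system `(Y, g)`, where
`Y` is a set with `g(Y) ⊆ Y`. The orbit segments are `(x i, n i)` for `i < k`, and `q i` is the gap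
after the `i`-th segment. -/
def NonuniformSpecification {M : Type*} [MetricSpace M] (g : M → M) (Y : Set M) : Prop :=
  ∀ ε : ℝ, 0 < ε → ∃ p : ℕ → ℕ, (∀ n, 1 ≤ n → 1 ≤ p n) ∧
    Tendsto (fun n : ℕ => (p n : ℝ) / n) atTop (𝓝 0) ∧
    ∀ (k : ℕ) (x : ℕ → M) (n q : ℕ → ℕ), 1 ≤ k → (∀ i < k, x i ∈ Y) → (∀ i < k, 1 ≤ n i) →
      (∀ i < k, p (n i) ≤ q i) →
      ∃ y ∈ Y, ∀ i < k, g^[∑ j ∈ Finset.range i, (n j + q j)] y ∈ dynBall g (n i) (x i) ε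

/-- The `S`-shrinking target set: the points `x` with `d(fⁿ x, zₙ) < φ n` for infinitely many
`n ∈ S`. -/
def targetSet {M : Type*} [MetricSpace M] (f : M → M) (φ : ℕ → ℝ) (z : ℕ → M) (S : Set ℕ) :
    Set M :=
  {x | {n | n ∈ S ∧ dist (f^[n] x) (z n) < φ n}.Infinite}

/-- The index set `Ind(𝒵, S, Y)` of a sequence of points `z` and a sequence of times `s`. -/
def Ind {M : Type*} (f : M → M) (N : ℕ) (Y : Set M) (z : ℕ → M) (s : ℕ → ℕ) : Set (ℕ × ℕ) :=
  {I | I.1 < N ∧ I.2 < N ∧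
    {i : ℕ | z (s i) ∈ f^[I.1] '' Y ∧ (N : ℤ) ∣ (s i : ℤ) - (I.2 : ℤ)}.Infinite}

/-- `Ind'(𝒵, S, Y) = {I₁ - I₂ : (I₁, I₂) ∈ Ind(𝒵, S, Y)}`, a set of integers. -/
def IndDiff {M : Type*} (f : M → M) (N : ℕ) (Y : Set M) (z : ℕ → M) (s : ℕ → ℕ) : Set ℤ :=
  (fun I : ℕ × ℕ => (I.1 : ℤ) - (I.2 : ℤ)) '' Ind f N Y z s

/-- `limsup_{n → ∞} -(ln φ(n)) / n ∈ [0, ∞]`, for `φ` with values in `(0, 1]`. -/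
noncomputable def upperRate (φ : ℕ → ℝ) : ℝ≥0∞ :=
  limsup (fun n : ℕ => ENNReal.ofReal (-Real.log (φ n) / n)) atTop

/-- `liminf_{n → ∞} -(ln φ(n)) / n ∈ [0, ∞]`, for `φ` with values in `(0, 1]`. -/
noncomputable def lowerRate (φ : ℕ → ℝ) : ℝ≥0∞ :=
  liminf (fun n : ℕ => ENNReal.ofReal (-Real.log (φ n) / n)) atTop

end Dynamics

end ShrinkingTarget

open ShrinkingTarget

/-! Entropy and dimension are both governed by the sums `∑ exp (-s nᵢ)` over countable covers by
cylinders: cylinders of length `n` are exactly the dynamical balls of scale `exp (-1)`, and sets of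
diameter about `exp (-n)` lie in cylinders of length about `n`. So `HasSmallCovers` bounds both
quantities from above and `CoverWeightGE` bounds both from below.

Upper bound (`hasSmallCovers_of_subset_targetSet`). One target set suffices. If `x` hits the target
at time `n` and `φ n ≤ exp (-τ n)`, the first `n` symbols of `x` already determine the first `(1 +
τ) n`. Hence about `exp (h n)` cylinders of length `(1 + τ) n` cover the points hitting at time `n`,
with `h` the entropy of the shift. The sum over `n` converges when `s (1 + τ) > h`, and its tails
cover the limsup set.

Lower bound (`exists_coverWeightGE_iInter_targetSet`). By compactness, specification lets a single
point of `Y` follow infinitely many prescribed orbit segments (`IsGapFunction`). Target segments are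
placed at extremely sparse times `N * q k`, serving every `j` infinitely often; all remaining cells
of a fixed length carry words chosen freely from about `exp (h N M)` possibilities. The uniform
product measure on the choices is a mass distribution on the target set. The worst scale is the end
of a target segment: the prefix has length about `(1 + τ) N q k`, while its free part has length
about `N q k`, whence the factor `1 / (1 + τ)` (`mul_le_freeCount_add`).

The constructed point is `f^a y` with `y ∈ Y`, so a target can be met only at times in suitable
classes modulo `N`. A common element of the sets `IndDiff` supplies one `a` good for all `j`
(`frequently_and_aligned`). Along prescribed times only the limsup rate is controlled; if all
positive times are allowed, times realizing the liminf can be selected, and the bounds meet. -/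

set_option linter.unusedSectionVars false

namespace ShrinkingTarget

/-! ### Cylinders, metric balls and dynamical balls. -/

section Cylinders

variable {A : Type*} [TopologicalSpace A] [DiscreteTopology A]
  {X : SymbolicDynamics.FullShift.Subshift A ℕ}

theorem subshiftMap_apply (x : X.carrier) (i : ℕ) : (subshiftMap X x).1 i = x.1 (1 + i) := rfl

theorem subshiftMap_iterate_apply (n : ℕ) (x : X.carrier) (i : ℕ) :
    ((subshiftMap X)^[n] x).1 i = x.1 (n + i) := by
  induction n generalizing x with
  | zero => simp
  | succ n ih =>
    rw [Function.iterate_succ_apply, ih, subshiftMap_apply]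
    exact congrArg x.1 (by omega)

theorem dist_eq_shiftDist (x y : X.carrier) : dist x y = shiftDist x.1 y.1 := rfl

theorem dist_lt_exp_neg_iff (x y : X.carrier) (n : ℕ) :
    dist x y < Real.exp (-(n : ℝ)) ↔ ∀ i < n, y.1 i = x.1 i := by
  rw [dist_eq_shiftDist, shiftDist_lt_iff]
  rfl

/-- The points of the subshift whose first `n` symbols are those of `x`. -/
def wordCylinder (x : X.carrier) (n : ℕ) : Set X.carrier := {y | ∀ i < n, y.1 i = x.1 i}

theorem dist_le_of_mem_wordCylinder {x y : X.carrier} {n : ℕ} (h : y ∈ wordCylinder x n) :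
    dist x y ≤ Real.exp (-(n : ℝ)) := ((dist_lt_exp_neg_iff x y n).2 h).le

theorem dynBall_exp_neg_one (x : X.carrier) (n : ℕ) :
    dynBall (subshiftMap X) n x (Real.exp (-1)) = wordCylinder x n := by
  ext y
  simp only [dynBall, wordCylinder, mem_ofPred_eq]
  refine forall₂_congr fun i _ => ?_
  have := dist_lt_exp_neg_iff ((subshiftMap X)^[i] x) ((subshiftMap X)^[i] y) 1
  simpa [subshiftMap_iterate_apply] using this

theorem wordCylinder_subset_dynBall (x : X.carrier) (n m : ℕ) {ε : ℝ}
    (hε : Real.exp (-(m : ℝ)) ≤ ε) :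
    wordCylinder x (n + m) ⊆ dynBall (subshiftMap X) n x ε := by
  intro y hy i hi
  refine lt_of_lt_of_le ((dist_lt_exp_neg_iff _ _ m).2 fun j hj => ?_) hε
  rw [subshiftMap_iterate_apply, subshiftMap_iterate_apply]
  exact hy _ (by omega)

theorem exists_exp_neg_natCast_le {ε : ℝ} (hε : 0 < ε) : ∃ m : ℕ, Real.exp (-(m : ℝ)) ≤ ε := by
  have ht : Tendsto (fun n : ℕ => Real.exp (-(n : ℝ))) atTop (𝓝 0) :=
    Real.tendsto_exp_neg_atTop_nhds_zero.comp tendsto_natCast_atTop_atTop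
  obtain ⟨m, hm⟩ := ((tendsto_order.1 ht).2 ε hε).exists
  exact ⟨m, hm.le⟩

end Cylinders

/-! ### Cylinder covers as criteria for entropy and dimension. -/

section Criteria

variable {A : Type*} [TopologicalSpace A] [DiscreteTopology A]
  {X : SymbolicDynamics.FullShift.Subshift A ℕ}

/-- `Z` has covers by long cylinders with arbitrarily small total weight `∑ exp (-s nᵢ)`. -/
def HasSmallCovers (Z : Set X.carrier) (s : ℝ) : Prop :=
  ∀ (m : ℕ) (η : ℝ≥0∞), 0 < η → ∃ C : Set (X.carrier × ℕ), C.Countable ∧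
    (∀ b ∈ C, m ≤ b.2) ∧ Z ⊆ ⋃ b ∈ C, wordCylinder b.1 b.2 ∧
      ∑' b : C, ENNReal.ofReal (Real.exp (-(s * b.1.2))) ≤ η

/-- The weights `∑ exp (-s nᵢ)` of the countable covers of `Z` by cylinders are at least `c`. -/
def CoverWeightGE (Z : Set X.carrier) (s : ℝ) (c : ℝ≥0∞) : Prop :=
  ∀ C : Set (X.carrier × ℕ), C.Countable → Z ⊆ ⋃ b ∈ C, wordCylinder b.1 b.2 →
    c ≤ ∑' b : C, ENNReal.ofReal (Real.exp (-(s * b.1.2)))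

/-- A dynamical ball of scale `ε` contains a cylinder only `m = m(ε)` symbols longer. Shortening the
recorded length by `m` costs the constant factor `exp (s m)`, which arbitrarily small covers absorb.
-/
theorem bowenEntropy_le_of_hasSmallCovers {Z : Set X.carrier} {s : ℝ≥0}
    (h : HasSmallCovers Z s) : bowenEntropy (subshiftMap X) Z ≤ s := by
  refine iSup₂_le fun ε hε => iInf₂_le s ?_
  obtain ⟨m, hm⟩ := exists_exp_neg_natCast_le hε
  refine le_antisymm (iSup_le fun N => ?_) bot_le
  refine ENNReal.le_of_forall_pos_le_add fun η hη _ => ?_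
  rw [zero_add]
  set K : ℝ≥0∞ := ENNReal.ofReal (Real.exp (s * m)) with hK
  have hK0 : K ≠ 0 := by simp [hK, Real.exp_pos]
  have hKt : K ≠ ∞ := ENNReal.ofReal_ne_top
  obtain ⟨C, hC, hn, hcov, hsum⟩ := h (N + m) (η / K) (ENNReal.div_pos (by simpa using hη.ne') hKt)
  set g : X.carrier × ℕ → X.carrier × ℕ := fun b => (b.1, b.2 - m) with hg
  unfold bowenPremeasure
  refine (iInf₂_le_of_le (g '' C) (hC.image g) <| iInf₂_le_of_le ?_ ?_ le_rfl).trans ?_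
  · rintro _ ⟨b, hb, rfl⟩
    have := hn b hb
    simp only [hg]
    omega
  · intro y hy
    obtain ⟨b, hb, hyb⟩ := mem_iUnion₂.1 (hcov hy)
    refine mem_iUnion₂.2 ⟨g b, mem_image_of_mem g hb, wordCylinder_subset_dynBall _ _ m hm ?_⟩
    have := hn b hb
    rwa [show (b.2 - m) + m = b.2 by omega]
  · refine (ENNReal.tsum_le_tsum_comp_of_surjective
      (imageFactorization_surjective (f := g) (s := C)) _).trans ?_
    calc ∑' b : C, ENNReal.ofReal (Real.exp (-((s : ℝ) * ((b.1.2 - m : ℕ) : ℝ))))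
          = ∑' b : C, K * ENNReal.ofReal (Real.exp (-(s * b.1.2))) := by
            refine tsum_congr fun b => ?_
            rw [hK, ← ENNReal.ofReal_mul (Real.exp_pos _).le, ← Real.exp_add]
            have := hn b b.2
            rw [Nat.cast_sub (by omega)]
            congr 2
            ring
        _ = K * ∑' b : C, ENNReal.ofReal (Real.exp (-(s * b.1.2))) := ENNReal.tsum_mul_left
        _ ≤ K * (η / K) := by gcongr
        _ = η := ENNReal.mul_div_cancel hK0 hKt

theorem le_bowenEntropy_of_coverWeightGE {Z : Set X.carrier} {s : ℝ≥0} {c : ℝ≥0∞}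
    (hc : c ≠ 0) (h : CoverWeightGE Z s c) : s ≤ bowenEntropy (subshiftMap X) Z := by
  refine le_iSup₂_of_le (Real.exp (-1)) (Real.exp_pos _) (le_iInf₂ fun s' hs' => ?_)
  by_contra! hlt
  have hlt : s' < s := by exact_mod_cast hlt
  refine hc (le_antisymm ?_ bot_le)
  have h0 : bowenPremeasure (subshiftMap X) Z (Real.exp (-1)) s' 0 = 0 :=
    le_antisymm ((le_iSup _ 0).trans hs'.le) bot_le
  change c ≤ 0
  rw [← h0]
  refine le_iInf fun C => le_iInf fun hC => le_iInf fun _ => le_iInf fun hcov => ?_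
  refine (h C hC ?_).trans ?_
  · simpa only [dynBall_exp_neg_one] using hcov
  · refine ENNReal.tsum_le_tsum fun b => ENNReal.ofReal_le_ofReal (Real.exp_le_exp.2 ?_)
    have : (s' : ℝ) ≤ s := by exact_mod_cast hlt.le
    gcongr

theorem ediam_wordCylinder_le (x : X.carrier) (n : ℕ) :
    Metric.ediam (wordCylinder x n) ≤ ENNReal.ofReal (Real.exp (-(n : ℝ))) := by
  refine Metric.ediam_le fun y hy z hz => ?_
  rw [edist_dist]
  refine ENNReal.ofReal_le_ofReal (dist_le_of_mem_wordCylinder fun i hi => ?_)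
  rw [hz i hi, hy i hi]

theorem dimH_le_of_hasSmallCovers {Z : Set X.carrier} {s : ℝ≥0}
    (h : HasSmallCovers Z s) : dimH Z ≤ s := by
  borelize ↥X.carrier
  refine dimH_le_of_hausdorffMeasure_ne_top (ne_top_of_le_ne_top ENNReal.one_ne_top ?_)
  choose C hC hn hcov hsum using fun m : ℕ => h m 1 one_pos
  have := fun m => (hC m).to_subtype
  refine (MeasureTheory.Measure.hausdorffMeasure_le_liminf_tsum (s : ℝ) Z (l := atTop)
    (fun m : ℕ => ENNReal.ofReal (Real.exp (-(m : ℝ)))) ?_ 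
    (fun m (b : C m) => wordCylinder b.1.1 b.1.2) ?_
    (Eventually.of_forall fun m => by simpa only [iUnion_coe_set] using hcov m)).trans ?_
  · rw [← ENNReal.ofReal_zero]
    exact ENNReal.tendsto_ofReal
      (Real.tendsto_exp_neg_atTop_nhds_zero.comp tendsto_natCast_atTop_atTop)
  · refine Eventually.of_forall fun m i => (ediam_wordCylinder_le _ _).trans ?_
    refine ENNReal.ofReal_le_ofReal (Real.exp_le_exp.2 ?_)
    have : (m : ℝ) ≤ i.1.2 := by exact_mod_cast hn m i i.2
    linarith
  · refine (liminf_le_liminf (v := fun _ => (1 : ℝ≥0∞)) (Eventually.of_forall fun m => ?_)).trans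
      (by simp)
    refine (ENNReal.tsum_le_tsum fun i => ?_).trans (hsum m)
    refine (ENNReal.rpow_le_rpow (ediam_wordCylinder_le _ _) s.2).trans ?_
    rw [ENNReal.ofReal_rpow_of_pos (Real.exp_pos _), ← Real.exp_mul]
    refine ENNReal.ofReal_le_ofReal (Real.exp_le_exp.2 ?_)
    apply le_of_eq
    change -(i.1.2 : ℝ) * (s : ℝ) = _
    ring

/-- Any efficient cover by small sets becomes one by cylinders at the cost of a factor `exp s` and a
summable error. The error is needed for sets of diameter zero, whose cylinders may be taken as long
as desired; this is where `0 < s` enters. -/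
theorem le_dimH_of_coverWeightGE {Z : Set X.carrier} {s : ℝ≥0} {c : ℝ≥0∞} (hs : 0 < s)
    (hc : c ≠ 0) (h : CoverWeightGE Z s c) : s ≤ dimH Z := by
  borelize ↥X.carrier
  refine le_dimH_of_hausdorffMeasure_ne_zero fun h0 => ?_
  obtain ⟨c', hc'0, hc'⟩ : ∃ c' : ℝ≥0, 0 < c' ∧ (c' : ℝ≥0∞) < c := by
    obtain ⟨c', h1, h2⟩ := ENNReal.lt_iff_exists_nnreal_btwn.1 (pos_iff_ne_zero.2 hc)
    exact ⟨c', by exact_mod_cast h1, h2⟩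
  set K : ℝ≥0∞ := ENNReal.ofReal (Real.exp s) with hK
  have hK0 : K ≠ 0 := by simp [hK, Real.exp_pos]
  have hKt : K ≠ ∞ := ENNReal.ofReal_ne_top
  have hpre := (MeasureTheory.Measure.hausdorffMeasure_apply (s : ℝ) Z).symm.trans h0
  simp only [ENNReal.iSup_eq_zero] at hpre
  have hpre1 := hpre (ENNReal.ofReal (Real.exp (-1))) (by simp [Real.exp_pos])
  have hlt : (⨅ (t : ℕ → Set X.carrier) (_ : Z ⊆ ⋃ n, t n)
      (_ : ∀ n, Metric.ediam (t n) ≤ ENNReal.ofReal (Real.exp (-1))),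
        ∑' n, ⨆ _ : (t n).Nonempty, Metric.ediam (t n) ^ (s : ℝ)) < (c' / 2 : ℝ≥0) / K := by
    rw [hpre1]
    refine ENNReal.div_pos ?_ hKt
    have : 0 < c' / 2 := by positivity
    exact_mod_cast this.ne'
  simp only [iInf_lt_iff] at hlt
  obtain ⟨t, hcov, hdiam, hsum⟩ := hlt
  obtain ⟨δ, hδ0, hδ⟩ := ENNReal.exists_pos_sum_of_countable
    (ε := ((c' / 2 : ℝ≥0) : ℝ≥0∞)) (by have : 0 < c' / 2 := by positivity
                                       exact_mod_cast this.ne') ℕ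
  have key : ∀ i : ℕ, (t i).Nonempty → ∃ (x : X.carrier) (n : ℕ), t i ⊆ wordCylinder x n ∧
      ENNReal.ofReal (Real.exp (-(s * n))) ≤ K * Metric.ediam (t i) ^ (s : ℝ) + δ i := by
    intro i ⟨x, hx⟩
    have hsub : ∀ n : ℕ, Metric.ediam (t i) < ENNReal.ofReal (Real.exp (-(n : ℝ))) →
        t i ⊆ wordCylinder x n := by
      intro n hn y hy
      refine (dist_lt_exp_neg_iff x y n).1 ?_
      rw [← ENNReal.ofReal_lt_ofReal_iff (Real.exp_pos _), ← edist_dist]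
      exact (Metric.edist_le_ediam_of_mem hx hy).trans_lt hn
    rcases eq_or_ne (Metric.ediam (t i)) 0 with hd | hd
    · obtain ⟨m, hm⟩ := exists_exp_neg_natCast_le (ε := (δ i : ℝ)) (hδ0 i)
      refine ⟨x, ⌈(m : ℝ) / s⌉₊, hsub _ ?_, ?_⟩
      · rw [hd]
        simp [Real.exp_pos]
      · refine le_trans ?_ le_add_self
        rw [← ENNReal.ofReal_coe_nnreal]
        refine ENNReal.ofReal_le_ofReal (le_trans (Real.exp_le_exp.2 ?_) hm)
        have h1 := Nat.le_ceil ((m : ℝ) / s)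
        rw [div_le_iff₀ (by exact_mod_cast hs)] at h1
        linarith
    · have hlt1 := (hdiam i)
      set d := (Metric.ediam (t i)).toReal with hdd
      have hdt : Metric.ediam (t i) ≠ ∞ := ne_top_of_le_ne_top ENNReal.ofReal_ne_top hlt1
      have hd' : Metric.ediam (t i) = ENNReal.ofReal d := (ENNReal.ofReal_toReal hdt).symm
      have hdpos : 0 < d := ENNReal.toReal_pos hd hdt
      rw [hd', ENNReal.ofReal_le_ofReal_iff (Real.exp_pos _).le] at hlt1
      have hlog : 1 ≤ -Real.log d := by
        have := Real.log_le_log hdpos hlt1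
        rw [Real.log_exp] at this
        linarith
      have hceil : 1 ≤ ⌈-Real.log d⌉₊ := Nat.one_le_ceil_iff.2 (by linarith)
      -- The largest `n` with `d < exp (-n)`; the restriction to diameters at most `exp (-1)` makes
      -- the subtraction genuine.
      refine ⟨x, ⌈-Real.log d⌉₊ - 1, hsub _ ?_, ?_⟩
      · rw [hd', ENNReal.ofReal_lt_ofReal_iff (Real.exp_pos _), Nat.cast_sub hceil,
          ← Real.log_lt_iff_lt_exp hdpos]
        have := Nat.ceil_lt_add_one (a := -Real.log d) (by linarith)
        push_cast
        linarith
      · refine le_trans ?_ le_self_add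
        rw [hd', ENNReal.ofReal_rpow_of_pos hdpos, hK, ← ENNReal.ofReal_mul (Real.exp_pos _).le]
        refine ENNReal.ofReal_le_ofReal ?_
        rw [Real.rpow_def_of_pos hdpos, ← Real.exp_add, Nat.cast_sub hceil]
        refine Real.exp_le_exp.2 ?_
        have h1 := Nat.le_ceil (-Real.log d)
        have h2 : (0 : ℝ) ≤ s := s.2
        push_cast
        nlinarith
  choose! x n hsub hw using key
  set g : {i : ℕ // (t i).Nonempty} → X.carrier × ℕ := fun i => (x i i.2, n i) with hg
  have hle := h (range g) (countable_range g) (fun y hy => by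
    obtain ⟨i, hi⟩ := mem_iUnion.1 (hcov hy)
    exact mem_iUnion₂.2 ⟨g ⟨i, y, hi⟩, mem_range_self _, hsub i ⟨y, hi⟩ hi⟩)
  refine (hle.trans ?_).not_gt hc'
  calc ∑' b : range g, ENNReal.ofReal (Real.exp (-(s * b.1.2)))
      ≤ ∑' i : {i : ℕ // (t i).Nonempty}, ENNReal.ofReal (Real.exp (-(s * n i))) :=
        ENNReal.tsum_le_tsum_comp_of_surjective rangeFactorization_surjective _
    _ ≤ ∑' i : {i : ℕ // (t i).Nonempty},
        (K * (⨆ _ : (t i).Nonempty, Metric.ediam (t i) ^ (s : ℝ)) + δ i) := by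
        refine ENNReal.tsum_le_tsum fun i => ?_
        rw [ciSup_pos i.2]
        exact hw i i.2
    _ ≤ ∑' i : ℕ, (K * (⨆ _ : (t i).Nonempty, Metric.ediam (t i) ^ (s : ℝ)) + δ i) :=
        ENNReal.tsum_comp_le_tsum_of_injective Subtype.val_injective _
    _ = K * (∑' i : ℕ, ⨆ _ : (t i).Nonempty, Metric.ediam (t i) ^ (s : ℝ)) + ∑' i, (δ i : ℝ≥0∞) := by
        rw [ENNReal.tsum_add, ENNReal.tsum_mul_left]
    _ ≤ K * ((c' / 2 : ℝ≥0) / K) + (c' / 2 : ℝ≥0) := by gcongr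
    _ = c' := by
        rw [ENNReal.mul_div_cancel hK0 hKt, ← ENNReal.coe_add, add_halves]

end Criteria

/-! ### Topological entropy as the growth rate of words. -/

section WordCount

variable {A : Type*} [TopologicalSpace A] [DiscreteTopology A]
  {X : SymbolicDynamics.FullShift.Subshift A ℕ}

/-- The initial word of length `n` of a point of a subshift. -/
def initialWord (n : ℕ) (x : X.carrier) : Fin n → A := fun i => x.1 i

theorem initialWord_eq_iff {n : ℕ} {x y : X.carrier} :
    initialWord n y = initialWord n x ↔ y ∈ wordCylinder x n :=
  ⟨fun h i hi => congrFun h ⟨i, hi⟩, fun h => funext fun i => h i i.2⟩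

/-- The number of initial words of length `n` of the points of `Z`. -/
noncomputable def wordCount (Z : Set X.carrier) (n : ℕ) : ℕ := (initialWord n '' Z).ncard

theorem wordCount_mono [Finite A] {Z W : Set X.carrier} (h : Z ⊆ W) (n : ℕ) :
    wordCount Z n ≤ wordCount W n := ncard_le_ncard (image_mono h)

theorem wordCount_le_pow [Finite A] (Z : Set X.carrier) (n : ℕ) :
    wordCount Z n ≤ Nat.card A ^ n := by
  refine (ncard_le_card _).trans ?_
  rw [Nat.card_fun, Nat.card_fin]

theorem exists_representatives [Finite A] (Z : Set X.carrier) (n : ℕ) :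
    ∃ R ⊆ Z, R.Finite ∧ R.ncard = wordCount Z n ∧ InjOn (initialWord n) R ∧
      ∀ x ∈ Z, ∃ r ∈ R, x ∈ wordCylinder r n := by
  obtain ⟨R, hRZ, hR⟩ := (surjOn_image (initialWord n) Z).exists_bijOn_subset
  refine ⟨R, hRZ, Set.Finite.of_finite_image (toFinite _) hR.injOn, ?_, hR.injOn, fun x hx => ?_⟩
  · rw [wordCount, ← hR.image_eq, hR.injOn.ncard_image]
  · obtain ⟨r, hr, hrx⟩ := hR.surjOn (mem_image_of_mem _ hx)
    exact ⟨r, hr, initialWord_eq_iff.1 hrx.symm⟩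

theorem wordCount_le_maxSeparated [Finite A] (n : ℕ) {ε : ℝ} (hε : ε < Real.exp (-1)) :
    (wordCount (univ : Set X.carrier) n : ℕ∞) ≤ maxSeparated (subshiftMap X) n ε := by
  obtain ⟨R, -, hfin, hcard, hinj, -⟩ := exists_representatives (univ : Set X.carrier) n
  rw [← hcard, hfin.cast_ncard_eq]
  refine le_iSup₂_of_le R (fun x hx y hy hxy => ?_) le_rfl
  by_contra! hcon
  refine hxy (hinj hx hy (initialWord_eq_iff.2 ?_))
  rw [← dynBall_exp_neg_one]
  intro i hi
  rw [dist_comm]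
  exact (hcon i hi).trans_lt hε

theorem maxSeparated_le_wordCount [Finite A] (n m : ℕ) {ε : ℝ} (hε : Real.exp (-(m : ℝ)) ≤ ε) :
    maxSeparated (subshiftMap X) n ε ≤ (wordCount (univ : Set X.carrier) (n + m) : ℕ∞) := by
  refine iSup₂_le fun E hE => ?_
  have hinj : InjOn (initialWord (n + m)) E := by
    intro x hx y hy hxy
    by_contra hne
    obtain ⟨k, hk, hlt⟩ := hE x hx y hy hne
    exact hlt.not_gt (wordCylinder_subset_dynBall x n m hε (initialWord_eq_iff.1 hxy.symm) k hk)
  rw [wordCount, ← hinj.encard_image, (toFinite _).cast_ncard_eq]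
  exact encard_le_encard (image_mono (subset_univ E))

theorem log_div_natCast_lt_iff (K : ℝ≥0∞) {n : ℕ} (hn : 0 < n) (H : ℝ) :
    ENNReal.log K / ((n : ℝ) : EReal) < (H : EReal) ↔ K < ENNReal.ofReal (Real.exp (H * n)) := by
  rw [EReal.div_lt_iff (by exact_mod_cast hn) (EReal.coe_ne_top _), ← ENNReal.log_lt_log_iff,
    ENNReal.log_ofReal_of_pos (Real.exp_pos _), Real.log_exp, EReal.coe_mul]

theorem lt_log_div_natCast_iff (K : ℝ≥0∞) {n : ℕ} (hn : 0 < n) (H : ℝ) :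
    (H : EReal) < ENNReal.log K / ((n : ℝ) : EReal) ↔ ENNReal.ofReal (Real.exp (H * n)) < K := by
  rw [EReal.lt_div_iff (by exact_mod_cast hn) (EReal.coe_ne_top _), ← ENNReal.log_lt_log_iff,
    ENNReal.log_ofReal_of_pos (Real.exp_pos _), Real.log_exp, EReal.coe_mul]

theorem toENNReal_le_ofReal_iff {x : EReal} {H : ℝ} (hH : 0 ≤ H) :
    x.toENNReal ≤ ENNReal.ofReal H ↔ x ≤ H := by
  constructor
  · intro h
    have h' : (x.toENNReal : EReal) ≤ (ENNReal.ofReal H : EReal) := by exact_mod_cast h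
    rw [EReal.coe_toENNReal_eq_max, EReal.coe_ennreal_ofReal, max_eq_left hH] at h'
    exact (le_max_right _ _).trans h'
  · intro h
    simpa using EReal.toENNReal_le_toENNReal h

/-- Separated sets at scale `ε` are counted by words `m` symbols longer. An intermediate rate `q >
H` absorbs this shift of length. -/
theorem frequently_exp_le_wordCount [Finite A] {H : ℝ} (hH : 0 ≤ H)
    (h : ENNReal.ofReal H < topEntropy (subshiftMap X)) :
    ∃ᶠ n : ℕ in atTop, Real.exp (H * n) ≤ wordCount (univ : Set X.carrier) n := by
  obtain ⟨q, hHq, hq⟩ := ENNReal.lt_iff_exists_nnreal_btwn.1 h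
  have hHq : H < q := by
    rwa [← ENNReal.ofReal_coe_nnreal, ENNReal.ofReal_lt_ofReal_iff_of_nonneg hH] at hHq
  simp only [topEntropy, lt_iSup_iff] at hq
  obtain ⟨ε, hε, hq⟩ := hq
  rw [← ENNReal.ofReal_coe_nnreal, ← not_le, toENNReal_le_ofReal_iff q.coe_nonneg, not_le] at hq
  have hfreq := frequently_lt_of_lt_limsup (by isBoundedDefault) hq
  obtain ⟨m, hm⟩ := exists_exp_neg_natCast_le hε
  have hev : ∀ᶠ n : ℕ in atTop, 0 < n ∧ H * ((n + m : ℕ) : ℝ) ≤ q * n := by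
    filter_upwards [eventually_gt_atTop 0,
      tendsto_natCast_atTop_atTop.eventually_ge_atTop (H * m / (q - H))] with n hn0 hn
    rw [div_le_iff₀ (by linarith)] at hn
    refine ⟨hn0, ?_⟩
    push_cast
    linarith
  have hmap : Tendsto (fun n : ℕ => n + m) atTop atTop := tendsto_add_atTop_nat m
  refine hmap.frequently ((hfreq.and_eventually hev).mono fun n ⟨h1, hn, h2⟩ => ?_)
  rw [lt_log_div_natCast_iff _ hn] at h1
  have h3 : ENNReal.ofReal (Real.exp (q * n)) ≤
      ENNReal.ofReal (wordCount (univ : Set X.carrier) (n + m)) := by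
    rw [ENNReal.ofReal_natCast]
    refine h1.le.trans ?_
    exact_mod_cast ENat.toENNReal_mono (maxSeparated_le_wordCount (X := X) n m hm)
  rw [ENNReal.ofReal_le_ofReal_iff (Nat.cast_nonneg _)] at h3
  exact (Real.exp_le_exp.2 h2).trans h3

theorem eventually_wordCount_le_exp [Finite A] {H : ℝ}
    (h : topEntropy (subshiftMap X) < ENNReal.ofReal H) :
    ∀ᶠ n : ℕ in atTop, (wordCount (univ : Set X.carrier) n : ℝ) ≤ Real.exp (H * n) := by
  have h1 := (le_iSup₂ (f := fun (ε : ℝ) (_ : 0 < ε) => (limsup (fun n : ℕ =>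
    ENNReal.log (maxSeparated (subshiftMap X) n ε : ℝ≥0∞) / ((n : ℝ) : EReal)) atTop).toENNReal)
    (Real.exp (-2)) (Real.exp_pos _)).trans_lt h
  have h2 : limsup (fun n : ℕ => ENNReal.log
      (maxSeparated (subshiftMap X) n (Real.exp (-2)) : ℝ≥0∞) / ((n : ℝ) : EReal)) atTop < H := by
    by_contra! hcon
    exact h1.not_ge (by simpa using EReal.toENNReal_le_toENNReal hcon)
  filter_upwards [eventually_lt_of_limsup_lt h2, eventually_gt_atTop 0] with n hn hn0
  rw [log_div_natCast_lt_iff _ hn0] at hn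
  have h3 : ENNReal.ofReal (wordCount (univ : Set X.carrier) n) ≤
      ENNReal.ofReal (Real.exp (H * n)) := by
    rw [ENNReal.ofReal_natCast]
    refine le_trans ?_ hn.le
    exact_mod_cast ENat.toENNReal_mono (wordCount_le_maxSeparated (X := X) n
      (Real.exp_lt_exp.2 (by norm_num : (-2 : ℝ) < -1)))
  rwa [ENNReal.ofReal_le_ofReal_iff (Real.exp_pos _).le] at h3

theorem topEntropy_ne_top [Finite A] : topEntropy (subshiftMap X) ≠ ∞ := by
  -- Only finiteness matters: the `+ 1` avoids the logarithm of zero, and the factor `2` below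
  -- absorbs the extra `m` symbols.
  set c : ℝ := Real.log (Nat.card A + 1) with hc
  have hc0 : 0 ≤ c := Real.log_nonneg (by simp)
  refine ne_top_of_le_ne_top (ENNReal.ofReal_ne_top (r := 2 * c)) (iSup₂_le fun ε hε => ?_)
  obtain ⟨m, hm⟩ := exists_exp_neg_natCast_le hε
  rw [toENNReal_le_ofReal_iff (by positivity)]
  refine limsup_le_of_le (by isBoundedDefault) ?_
  filter_upwards [eventually_ge_atTop (m + 1)] with n hn
  rw [← not_lt, lt_log_div_natCast_iff _ (by omega), not_lt]
  have h1 : (maxSeparated (subshiftMap X) n ε : ℝ≥0∞) ≤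
      ENNReal.ofReal (wordCount (univ : Set X.carrier) (n + m)) := by
    rw [ENNReal.ofReal_natCast]
    exact_mod_cast ENat.toENNReal_mono (maxSeparated_le_wordCount (X := X) n m hm)
  refine h1.trans (ENNReal.ofReal_le_ofReal ?_)
  calc (wordCount (univ : Set X.carrier) (n + m) : ℝ)
      ≤ ((Nat.card A : ℝ)) ^ (n + m) := by exact_mod_cast wordCount_le_pow _ _
    _ ≤ ((Nat.card A : ℝ) + 1) ^ (n + m) := by gcongr; linarith
    _ = Real.exp (c * (n + m : ℕ)) := by
        rw [hc, mul_comm, Real.exp_nat_mul, Real.exp_log (by positivity)]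
    _ ≤ Real.exp (2 * c * n) := by
        refine Real.exp_le_exp.2 ?_
        have : ((n + m : ℕ) : ℝ) ≤ 2 * n := by exact_mod_cast (by omega : n + m ≤ 2 * n)
        nlinarith

end WordCount

/-! ### Upper bounds by the natural limsup cover. -/

section UpperBound

variable {A : Type*} [TopologicalSpace A] [DiscreteTopology A]
  {X : SymbolicDynamics.FullShift.Subshift A ℕ}

theorem tsum_image_prodMk_le {R : Set X.carrier} (hR : R.Finite) (n : ℕ) (w : ℕ → ℝ≥0∞) :
    ∑' b : ((fun r => (r, n)) '' R : Set (X.carrier × ℕ)), w b.1.2 ≤ R.ncard * w n := by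
  refine (ENNReal.tsum_le_tsum_comp_of_surjective
    (imageFactorization_surjective (f := fun r => (r, n)) (s := R)) _).trans ?_
  refine (ENNReal.tsum_set_const R (w n)).le.trans ?_
  rw [← hR.cast_ncard_eq]
  simp

theorem hasSmallCovers_of_subset_targetSet [Finite A] {Z : Set X.carrier} {φ : ℕ → ℝ}
    {z : ℕ → X.carrier} {S : Set ℕ} (hZ : Z ⊆ targetSet (subshiftMap X) φ z S) {s H τ : ℝ}
    (hs : 0 ≤ s) (hτ : 0 ≤ τ) (hH : H < s * (1 + τ))
    (hφ : ∀ᶠ n : ℕ in atTop, φ n ≤ Real.exp (-(τ * n)))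
    (hW : ∀ᶠ n : ℕ in atTop, (wordCount (univ : Set X.carrier) n : ℝ) ≤ Real.exp (H * n)) :
    HasSmallCovers Z s := by
  intro m η hη
  set δ : ℝ := s * (1 + τ) - H with hδ
  have hsum : Summable fun n : ℕ => Real.exp s * Real.exp (n * -δ) :=
    (Real.summable_exp_nat_mul_iff.2 (by linarith)).mul_left _
  have htail := ENNReal.tendsto_sum_nat_add _ hsum.tsum_ofReal_ne_top
  obtain ⟨n₀, hn₀, hm, hall⟩ := (((tendsto_order.1 htail).2 η hη).and
    ((eventually_ge_atTop m).and (eventually_forall_ge_atTop.2 (hφ.and hW)))).exists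
  set Zn : ℕ → Set X.carrier := fun n => {x | dist ((subshiftMap X)^[n] x) (z n) < φ n} with hZn
  choose R hRZ hfin hcard hinj hrep using fun n => exists_representatives (Zn n) n
  -- Two points hitting the target at time `n` both copy `z n` for `⌊τ n⌋` symbols after time `n`,
  -- so agreement up to `n` extends to agreement up to `L n`. Rounding down costs at most a factor
  -- `exp s`.
  set L : ℕ → ℕ := fun n => n + ⌊τ * n⌋₊ with hL
  refine ⟨⋃ k : ℕ, (fun r => (r, L (k + n₀))) '' R (k + n₀),
    countable_iUnion fun k => ((hfin _).image _).countable, ?_, ?_, ?_⟩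
  · intro b hb
    obtain ⟨k, r, hr, rfl⟩ := mem_iUnion.1 hb
    simp only [hL]
    omega
  · intro x hx
    obtain ⟨n, ⟨-, hxn⟩, hn⟩ := (hZ hx).exists_gt n₀
    obtain ⟨r, hr, hxr⟩ := hrep n x hxn
    refine mem_iUnion₂.2 ⟨(r, L n), mem_iUnion.2 ⟨n - n₀, r, ?_, ?_⟩, ?_⟩
    · rwa [Nat.sub_add_cancel hn.le]
    · rw [Nat.sub_add_cancel hn.le]
    · have hclose : ∀ y ∈ Zn n, ∀ i < ⌊τ * n⌋₊, y.1 (n + i) = (z n).1 i := by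
        intro y hy i hi
        have h1 : dist (z n) ((subshiftMap X)^[n] y) < Real.exp (-(⌊τ * n⌋₊ : ℝ)) := by
          rw [dist_comm]
          refine lt_of_lt_of_le hy (((hall n hn.le).1).trans (Real.exp_le_exp.2 ?_))
          have := Nat.floor_le (a := τ * n) (by positivity)
          linarith
        rw [← (dist_lt_exp_neg_iff _ _ _).1 h1 i hi, subshiftMap_iterate_apply]
      intro i hi
      rcases lt_or_ge i n with hin | hin
      · exact hxr i hin
      · obtain ⟨i, rfl⟩ := Nat.exists_eq_add_of_le hin
        simp only [hL] at hi
        rw [hclose x hxn i (by omega), hclose r (hRZ n hr) i (by omega)]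
  · refine le_trans ?_ hn₀.le
    refine (ENNReal.tsum_iUnion_le_tsum (fun b : X.carrier × ℕ =>
      ENNReal.ofReal (Real.exp (-(s * b.2)))) _).trans (ENNReal.tsum_le_tsum fun k => ?_)
    refine (tsum_image_prodMk_le (hfin _) _
      (fun n => ENNReal.ofReal (Real.exp (-(s * n))))).trans ?_
    set n := k + n₀ with hn
    rw [← ENNReal.ofReal_natCast, ← ENNReal.ofReal_mul (Nat.cast_nonneg _)]
    refine ENNReal.ofReal_le_ofReal ?_
    have h1 : ((R n).ncard : ℝ) ≤ Real.exp (H * n) := by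
      rw [hcard]
      refine le_trans ?_ (hall n (by omega)).2
      exact_mod_cast wordCount_mono (subset_univ _) n
    calc ((R n).ncard : ℝ) * Real.exp (-(s * (L n : ℕ)))
        ≤ Real.exp (H * n) * Real.exp (-(s * (L n : ℕ))) := by gcongr
      _ ≤ Real.exp s * Real.exp (n * -δ) := by
        rw [← Real.exp_add, ← Real.exp_add]
        refine Real.exp_le_exp.2 ?_
        have h2 : n + τ * n ≤ (L n : ℕ) + 1 := by
          simp only [hL]
          push_cast
          linarith [Nat.lt_floor_add_one (τ * n)]
        have h3 := mul_le_mul_of_nonneg_left h2 hs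
        rw [hδ]
        linarith

theorem eventually_le_exp_of_lt_lowerRate {φ : ℕ → ℝ} (hφ : ∀ n, φ n ∈ Ioc (0 : ℝ) 1) {τ : ℝ≥0}
    (h : τ < lowerRate φ) : ∀ᶠ n : ℕ in atTop, φ n ≤ Real.exp (-(τ * n)) := by
  filter_upwards [eventually_lt_of_lt_liminf h, eventually_gt_atTop 0] with n hn hn0
  rw [← ENNReal.ofReal_coe_nnreal, ENNReal.ofReal_lt_ofReal_iff_of_nonneg τ.coe_nonneg,
    lt_div_iff₀ (by exact_mod_cast hn0)] at hn
  rw [← Real.log_le_iff_le_exp (hφ n).1]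
  linarith

theorem hasSmallCovers_of_lt [Finite A] {φ : ℕ → ℕ → ℝ} (hφ : ∀ j n, φ j n ∈ Ioc (0 : ℝ) 1)
    {z : ℕ → ℕ → X.carrier} {S : ℕ → Set ℕ} {s : ℝ≥0}
    (h : (1 + ⨆ j, lowerRate (φ j))⁻¹ * topEntropy (subshiftMap X) < s) :
    HasSmallCovers (⋂ j, targetSet (subshiftMap X) (φ j) (z j) (S j)) s := by
  have hT := topEntropy_ne_top (X := X)
  rw [mul_comm, ← div_eq_mul_inv, ENNReal.div_lt_iff (by simp) (Or.inr hT), ENNReal.add_iSup,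
    ENNReal.mul_iSup, lt_iSup_iff] at h
  obtain ⟨j, hj⟩ := h
  obtain ⟨τ, hτ, hφτ⟩ : ∃ τ : ℝ≥0, topEntropy (subshiftMap X) < (s : ℝ≥0∞) * (1 + τ) ∧
      ∀ᶠ n : ℕ in atTop, φ j n ≤ Real.exp (-(τ * n)) := by
    -- The case `τ = 0` is separate because it uses only `φ ≤ 1`; when `lowerRate (φ j) = 0` there
    -- is no `τ` strictly below it.
    rcases lt_or_ge (topEntropy (subshiftMap X)) s with hlt | hge
    · exact ⟨0, by simpa using hlt, Eventually.of_forall fun n => by simpa using (hφ j n).2⟩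
    · have hs0 : (s : ℝ≥0∞) ≠ 0 := by
        rintro h0
        simp [h0] at hj
      rw [mul_comm, ← ENNReal.div_lt_iff (Or.inl hs0) (Or.inr hT)] at hj
      have h1 : 1 ≤ topEntropy (subshiftMap X) / s := by
        rw [ENNReal.le_div_iff_mul_le (Or.inl hs0) (Or.inr hT)]
        simpa using hge
      have h2 : topEntropy (subshiftMap X) / s - 1 < lowerRate (φ j) := by
        rwa [ENNReal.sub_lt_iff_lt_left ENNReal.one_ne_top h1]
      obtain ⟨τ, hτ1, hτ2⟩ := ENNReal.lt_iff_exists_nnreal_btwn.1 h2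
      refine ⟨τ, ?_, eventually_le_exp_of_lt_lowerRate (hφ j) hτ2⟩
      rwa [ENNReal.sub_lt_iff_lt_left ENNReal.one_ne_top h1, ENNReal.div_lt_iff (Or.inl hs0) (Or.inr hT), mul_comm] at hτ1
  obtain ⟨H, hH1, hH2⟩ := ENNReal.lt_iff_exists_nnreal_btwn.1 hτ
  refine hasSmallCovers_of_subset_targetSet (iInter_subset _ j) (H := H) (τ := τ) s.coe_nonneg
    τ.coe_nonneg (by exact_mod_cast hH2) hφτ (eventually_wordCount_le_exp ?_)
  rwa [ENNReal.ofReal_coe_nnreal]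

theorem bowenEntropy_iInter_targetSet_le [Finite A] {φ : ℕ → ℕ → ℝ}
    (hφ : ∀ j n, φ j n ∈ Ioc (0 : ℝ) 1) (z : ℕ → ℕ → X.carrier) (S : ℕ → Set ℕ) :
    bowenEntropy (subshiftMap X) (⋂ j, targetSet (subshiftMap X) (φ j) (z j) (S j)) ≤
      (1 + ⨆ j, lowerRate (φ j))⁻¹ * topEntropy (subshiftMap X) := by
  refine le_of_forall_gt fun a ha => ?_
  obtain ⟨s, hs, hsa⟩ := ENNReal.lt_iff_exists_nnreal_btwn.1 ha
  exact (bowenEntropy_le_of_hasSmallCovers (hasSmallCovers_of_lt hφ hs)).trans_lt hsa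

theorem dimH_iInter_targetSet_le [Finite A] {φ : ℕ → ℕ → ℝ}
    (hφ : ∀ j n, φ j n ∈ Ioc (0 : ℝ) 1) (z : ℕ → ℕ → X.carrier) (S : ℕ → Set ℕ) :
    dimH (⋂ j, targetSet (subshiftMap X) (φ j) (z j) (S j)) ≤
      (1 + ⨆ j, lowerRate (φ j))⁻¹ * topEntropy (subshiftMap X) := by
  refine le_of_forall_gt fun a ha => ?_
  obtain ⟨s, hs, hsa⟩ := ENNReal.lt_iff_exists_nnreal_btwn.1 ha
  exact (dimH_le_of_hasSmallCovers (hasSmallCovers_of_lt hφ hs)).trans_lt hsa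

end UpperBound

/-! ### Specification for infinitely many exact segments. -/

section Shadowing

variable {A : Type*} [TopologicalSpace A] [DiscreteTopology A]
  {X : SymbolicDynamics.FullShift.Subshift A ℕ}

theorem isClosed_symbol_eq (i : ℕ) (a : A) : IsClosed {y : X.carrier | y.1 i = a} :=
  isClosed_eq ((continuous_apply i).comp continuous_subtype_val) continuous_const

theorem apply_eq_of_iterate_mem_dynBall {N : ℕ} (hN : 0 < N) {x y : X.carrier} {b n : ℕ}
    (h : ((subshiftMap X)^[N])^[b] y ∈ dynBall ((subshiftMap X)^[N]) n x (Real.exp (-(N : ℝ))))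
    {t : ℕ} (ht : t < N * n) : y.1 (N * b + t) = x.1 t := by
  have h1 := (dist_lt_exp_neg_iff _ _ _).1 (h (t / N) (Nat.div_lt_of_lt_mul ht)) (t % N)
    (Nat.mod_lt _ hN)
  simp only [← Function.iterate_mul, subshiftMap_iterate_apply, Nat.div_add_mod] at h1
  exact h1

/-- Infinitely many segments of length `N * ℓ b` of points `x b` of `Y`, placed at the times `N * b`
for `b ∈ B`, are shadowed by one point of `Y` if each of them is followed by a gap of length at
least `N * p (ℓ b)`. -/
def IsGapFunction (Y : Set X.carrier) (N : ℕ) (p : ℕ → ℕ) : Prop :=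
  ∀ (B : Set ℕ) (ℓ : ℕ → ℕ) (x : ℕ → X.carrier), B.Infinite → 0 ∈ B → (∀ b ∈ B, x b ∈ Y) →
    (∀ b ∈ B, 1 ≤ ℓ b) → (∀ b ∈ B, ∀ b' ∈ B, b < b' → b + ℓ b + p (ℓ b) ≤ b') →
    ∃ y ∈ Y, ∀ b ∈ B, ∀ t < N * ℓ b, y.1 (N * b + t) = (x b).1 t

theorem NonuniformSpecification.exists_isGapFunction {Y : Set X.carrier} (hYc : IsCompact Y)
    {N : ℕ} (hN : 0 < N) (hspec : NonuniformSpecification ((subshiftMap X)^[N]) Y) :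
    ∃ p : ℕ → ℕ, Tendsto (fun n : ℕ => (p n : ℝ) / n) atTop (𝓝 0) ∧ IsGapFunction Y N p := by
  -- Closeness below `exp (-N)` means agreement of `N` symbols, exactly one step of `f^N`, so
  -- shadowing at this scale gives equality of whole segments with no break.
  obtain ⟨p, -, hp, hshadow⟩ := hspec (Real.exp (-(N : ℝ))) (Real.exp_pos _)
  refine ⟨p, hp, fun B ℓ x hB h0 hx hℓ hgap => ?_⟩
  set β : ℕ → ℕ := Nat.nth (· ∈ B) with hβ
  have hmem : ∀ i, β i ∈ B := fun i => Nat.nth_mem_of_infinite hB i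
  have hmono : StrictMono β := Nat.nth_strictMono hB
  have hβ0 : β 0 = 0 := Nat.nth_zero_of_zero h0
  have hstep : ∀ i, β i + ℓ (β i) + p (ℓ (β i)) ≤ β (i + 1) := fun i =>
    hgap _ (hmem i) _ (hmem _) (hmono i.lt_succ_self)
  have hsum : ∀ i, ∑ j ∈ Finset.range i, (ℓ (β j) + (β (j + 1) - β j - ℓ (β j))) = β i := by
    intro i
    induction i with
    | zero => simp [hβ0]
    | succ i ih =>
      rw [Finset.sum_range_succ, ih]
      have := hstep i
      omega
  -- Points following the first `K + 1` segments: nested compact sets, nonempty by finite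
  -- specification with each gap stretched to reach the next starting time.
  set F : ℕ → Set X.carrier := fun K => Y ∩ ⋂ i ≤ K, ⋂ t < N * ℓ (β i),
    {y | y.1 (N * β i + t) = (x (β i)).1 t} with hF
  have hne : (⋂ K, F K).Nonempty := by
    refine IsCompact.nonempty_iInter_of_sequence_nonempty_isCompact_isClosed F
      (fun K => inter_subset_inter_right _ (biInter_mono (fun i hi => Nat.le_succ_of_le hi)
        fun _ _ => Subset.rfl)) (fun K => ?_) ?_ ?_
    · obtain ⟨y, hy, hshad⟩ := hshadow (K + 1) (fun i => x (β i)) (fun i => ℓ (β i))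
        (fun i => β (i + 1) - β i - ℓ (β i)) (by omega) (fun i _ => hx _ (hmem i))
        (fun i _ => hℓ _ (hmem i)) (fun i _ => by have := hstep i; omega)
      refine ⟨y, hy, mem_iInter₂.2 fun i hi => mem_iInter₂.2 fun t ht => ?_⟩
      have := hshad i (by omega)
      rw [hsum] at this
      exact apply_eq_of_iterate_mem_dynBall hN this ht
    · exact hYc.inter_right (isClosed_biInter fun i _ => isClosed_biInter fun t _ =>
        isClosed_symbol_eq _ _)
    · exact fun K => hYc.isClosed.inter (isClosed_biInter fun i _ => isClosed_biInter fun t _ =>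
        isClosed_symbol_eq _ _)
  obtain ⟨y, hy⟩ := hne
  refine ⟨y, (mem_iInter.1 hy 0).1, fun b hb t ht => ?_⟩
  obtain ⟨i, -, rfl⟩ := Nat.exists_lt_card_nth_eq (p := (· ∈ B)) hb
  exact mem_iInter₂.1 (mem_iInter₂.1 (mem_iInter.1 hy i).2 i le_rfl) t ht

end Shadowing

/-! ### Words of `Y` grow as fast as those of `X`. -/

section WordsOfBase

variable {A : Type*} [TopologicalSpace A] [DiscreteTopology A]
  {X : SymbolicDynamics.FullShift.Subshift A ℕ}

/-- Each point is `f^l y` with `y ∈ Y` and `l < N`, so its word of length `n` is read at offset `l`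
in the longer word of `y`. -/
theorem wordCount_univ_le_mul [Finite A] {Y : Set X.carrier} {N : ℕ}
    (hXY : ⋃ l ∈ Finset.range N, (subshiftMap X)^[l] '' Y = univ) {n m : ℕ} (hm : n + N ≤ m) :
    wordCount (univ : Set X.carrier) n ≤ N * wordCount Y m := by
  have hsub : initialWord (X := X) n '' univ ⊆
      (fun b : Fin N × (Fin m → A) => fun i : Fin n => b.2 ⟨b.1 + i, by omega⟩) ''
        ((univ : Set (Fin N)) ×ˢ (initialWord m '' Y)) := by
    rintro _ ⟨x, -, rfl⟩
    obtain ⟨l, hl, y, hy, rfl⟩ := mem_iUnion₂.1 (hXY ▸ mem_univ x)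
    refine ⟨(⟨l, Finset.mem_range.1 hl⟩, initialWord m y),
      ⟨mem_univ _, mem_image_of_mem _ hy⟩, funext fun i => ?_⟩
    simp [initialWord, subshiftMap_iterate_apply]
  refine (ncard_le_ncard hsub).trans ((ncard_image_le (toFinite _)).trans ?_)
  rw [ncard_prod, ncard_univ, Nat.card_fin]
  rfl

theorem frequently_exp_le_wordCount_of_iUnion_eq [Finite A] {Y : Set X.carrier} {N : ℕ} (hN : 0 < N)
    (hXY : ⋃ l ∈ Finset.range N, (subshiftMap X)^[l] '' Y = univ) {H : ℝ} (hH : 0 ≤ H)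
    (h : ENNReal.ofReal H < topEntropy (subshiftMap X)) :
    ∃ᶠ M : ℕ in atTop, Real.exp (H * (N * M : ℕ)) ≤ wordCount Y (N * M) := by
  obtain ⟨q, hHq, hq⟩ := ENNReal.lt_iff_exists_nnreal_btwn.1 h
  rw [← ENNReal.ofReal_coe_nnreal] at hHq hq
  rw [ENNReal.ofReal_lt_ofReal_iff_of_nonneg hH] at hHq
  have hmap : Tendsto (fun n : ℕ => n / N + 2) atTop atTop :=
    (tendsto_add_atTop_nat 2).comp (Nat.tendsto_div_const_atTop hN.ne')
  refine hmap.frequently (((frequently_exp_le_wordCount q.coe_nonneg hq).and_eventually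
    (tendsto_natCast_atTop_atTop.eventually_ge_atTop ((H * (2 * N) + Real.log N) / (q - H)))).mono
      fun n ⟨h1, h2⟩ => ?_)
  rw [div_le_iff₀ (by linarith)] at h2
  have hdiv := Nat.div_add_mod n N
  have hmod := Nat.mod_lt n hN
  have hlow : n + N ≤ N * (n / N + 2) := by rw [mul_add]; omega
  have hupp : ((N * (n / N + 2) : ℕ) : ℝ) ≤ n + 2 * N := by
    exact_mod_cast (by rw [mul_add]; omega : N * (n / N + 2) ≤ n + 2 * N)
  have hN' : (0 : ℝ) < N := by exact_mod_cast hN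
  have h3 : (wordCount (univ : Set X.carrier) n : ℝ) ≤ N * wordCount Y (N * (n / N + 2)) := by
    exact_mod_cast wordCount_univ_le_mul hXY hlow
  refine le_of_mul_le_mul_left (le_trans ?_ (h1.trans h3)) hN'
  nth_rw 1 [← Real.exp_log hN']
  rw [← Real.exp_add]
  refine Real.exp_le_exp.2 ?_
  have := mul_le_mul_of_nonneg_left hupp hH
  linarith

end WordsOfBase

/-! ### Sparse target times and the density of free cells. -/

section Schedule

theorem exists_sparse_schedule {P : ℕ → ℕ → ℕ → Prop} (hP : ∀ k b, ∃ q ℓ, b ≤ q ∧ P k q ℓ)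
    (p : ℕ → ℕ) (c D : ℕ) :
    ∃ q ℓ : ℕ → ℕ, (∀ k, P k (q k) (ℓ k)) ∧ c ≤ q 0 ∧
      ∀ k, D * (q k + ℓ k + p (ℓ k)) ≤ q (k + 1) := by
  choose q ℓ hq hPq using hP
  let b : ℕ → ℕ := fun k => Nat.rec c
    (fun k b => D * (q k b + ℓ k b + p (ℓ k b))) k
  exact ⟨fun k => q k (b k), fun k => ℓ k (b k), fun k => hPq _ _, hq 0 c, fun k => hq (k + 1) _⟩

/-- The `i`-th cell `[L i, L (i + 1))` avoids all the intervals `[q k, e k)`. -/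
def IsFreeCell (L : ℕ) (q e : ℕ → ℕ) (i : ℕ) : Prop := ∀ k, L * (i + 1) ≤ q k ∨ e k ≤ L * i

theorem isFreeCell_of_le_zero {L : ℕ} {q e : ℕ → ℕ} (hqe : ∀ k, q k ≤ e k)
    (heq : ∀ k, e k ≤ q (k + 1)) {i : ℕ} (hi : L * (i + 1) ≤ q 0) : IsFreeCell L q e i := by
  have hq : Monotone q := monotone_nat_of_le_succ fun k => (hqe k).trans (heq k)
  exact fun k => Or.inl (hi.trans (hq (Nat.zero_le k)))

theorem isFreeCell_of_le_of_le {L : ℕ} {q e : ℕ → ℕ} (hqe : ∀ k, q k ≤ e k)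
    (heq : ∀ k, e k ≤ q (k + 1)) {i k : ℕ} (h1 : e k ≤ L * i) (h2 : L * (i + 1) ≤ q (k + 1)) :
    IsFreeCell L q e i := by
  have hq : Monotone q := monotone_nat_of_le_succ fun k => (hqe k).trans (heq k)
  have he : Monotone e := monotone_nat_of_le_succ fun k => (heq k).trans (hqe _)
  intro k'
  rcases le_or_gt k' k with h | h
  · exact Or.inr ((he h).trans h1)
  · exact Or.inl (h2.trans (hq h))

open scoped Classical in
/-- The number of free cells among the first `m`. -/
noncomputable def freeCount (L : ℕ) (q e : ℕ → ℕ) (m : ℕ) : ℕ :=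
  ((Finset.range m).filter (IsFreeCell L q e)).card

theorem sub_add_sub_le_freeCount {L : ℕ} {q e : ℕ → ℕ} {u v u' m : ℕ} (hvu : v ≤ u') (hvm : v ≤ m)
    (h1 : ∀ i, u ≤ i → i < v → IsFreeCell L q e i)
    (h2 : ∀ i, u' ≤ i → i < m → IsFreeCell L q e i) :
    (v - u) + (m - u') ≤ freeCount L q e m := by
  classical
  rw [← Nat.card_Ico, ← Nat.card_Ico, ← Finset.card_union_of_disjoint, freeCount]
  · refine Finset.card_le_card fun i hi => ?_
    simp only [Finset.mem_union, Finset.mem_Ico, Finset.mem_filter, Finset.mem_range] at hi ⊢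
    rcases hi with hi | hi
    · exact ⟨by omega, h1 i hi.1 hi.2⟩
    · exact ⟨hi.2, h2 i hi.1 hi.2⟩
  · rw [Finset.disjoint_left]
    intro i hi hi'
    simp only [Finset.mem_Ico] at hi hi'
    omega

/-- Let `q k < L m ≤ q (k + 1)`. Everything before `q k` is free except an initial part of length at
most `q k / D`, and everything from `e k` to `L m` is free. The free proportion is therefore least
near `e k ≈ κ q k`, where it is `(1 - 1 / D) / κ`. Rounding to whole cells at the three endpoints
accounts for the `3`. -/
theorem mul_le_freeCount_add {L D : ℕ} (hL : 0 < L) (hD : 1 ≤ D) {q e : ℕ → ℕ}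
    (hqe : ∀ k, q k < e k) (heq : ∀ k, D * e k ≤ q (k + 1)) {κ C : ℝ} (hκ : 1 ≤ κ) (hC : 0 ≤ C)
    (he : ∀ k, (e k : ℝ) ≤ κ * q k + C) (m : ℕ) :
    (1 - 1 / D) / κ * m ≤ freeCount L q e m + (3 + C) := by
  have hqe' : ∀ k, q k ≤ e k := fun k => (hqe k).le
  have heq' : ∀ k, e k ≤ q (k + 1) := fun k => (Nat.le_mul_of_pos_left _ hD).trans (heq k)
  have hq : StrictMono q := strictMono_nat_of_lt_succ fun k => (hqe k).trans_le (heq' k)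
  have hL' : (1 : ℝ) ≤ L := by exact_mod_cast hL
  have hD' : (1 : ℝ) ≤ D := by exact_mod_cast hD
  have hDinv : 1 / (D : ℝ) ≤ 1 := by rw [div_le_one (by linarith)]; exact hD'
  have hDpos : 0 < 1 / (D : ℝ) := by positivity
  set θ : ℝ := (1 - 1 / D) / κ with hθ
  have hθ0 : 0 ≤ θ := div_nonneg (by linarith) (by linarith)
  have hθ1 : θ ≤ 1 := by
    rw [hθ, div_le_one (by linarith)]
    linarith
  have hθκ : θ * κ = 1 - 1 / D := by
    rw [hθ]
    field_simp
  rcases le_or_gt (L * m) (q 0) with hm | hm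
  · have h1 := sub_add_sub_le_freeCount (L := L) (q := q) (e := e) (u := 0) (v := m) (u' := m)
      le_rfl le_rfl (fun i _ hi => isFreeCell_of_le_zero hqe' heq'
        ((Nat.mul_le_mul_left L (Nat.succ_le_of_lt hi)).trans hm)) (fun i _ _ => by omega)
    have h2 : (m : ℝ) ≤ freeCount L q e m := by exact_mod_cast (by omega)
    nlinarith
  · obtain ⟨k, hk1, hk2⟩ : ∃ k, q k < L * m ∧ L * m ≤ q (k + 1) := by
      have hex : ∃ k, L * m ≤ q k := ⟨L * m, hq.le_apply⟩
      classical
      have hpos : Nat.find hex ≠ 0 := by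
        intro h0
        have := Nat.find_spec hex
        rw [h0] at this
        omega
      obtain ⟨k, hk⟩ := Nat.exists_eq_succ_of_ne_zero hpos
      refine ⟨k, ?_, ?_⟩
      · have := Nat.find_min hex (m := k) (by omega)
        omega
      · have := Nat.find_spec hex
        rwa [hk] at this
    obtain ⟨r, hr, hrfree⟩ : ∃ r : ℕ, (r : ℝ) ≤ 1 / D * q k ∧
        ∀ i, r ≤ L * i → L * (i + 1) ≤ q k → IsFreeCell L q e i := by
      cases k with
      | zero =>
        exact ⟨0, by simpa using by positivity,
          fun i _ hi => isFreeCell_of_le_zero hqe' heq' hi⟩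
      | succ k =>
        refine ⟨e k, ?_, fun i h1 h2 => isFreeCell_of_le_of_le hqe' heq' h1 h2⟩
        rw [one_div, ← div_eq_inv_mul, le_div_iff₀ (by linarith), mul_comm]
        exact_mod_cast heq k
    have hdiv1 := Nat.div_add_mod (q k) L
    have hdiv2 := Nat.div_add_mod (e k) L
    have hdiv3 := Nat.div_add_mod r L
    have hmod1 := Nat.mod_lt (q k) hL
    have hmod2 := Nat.mod_lt (e k) hL
    have hmod3 := Nat.mod_lt r hL
    have hcount := sub_add_sub_le_freeCount (L := L) (q := q) (e := e) (u := r / L + 1)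
      (v := q k / L) (u' := e k / L + 1) (m := m)
      ((Nat.div_le_div_right (hqe' k)).trans (Nat.le_succ _))
      (Nat.div_le_of_le_mul hk1.le)
      (fun i h1 h2 => hrfree i
        (by have := Nat.mul_le_mul_left L h1; rw [mul_add] at this; omega)
        (by have := Nat.mul_le_mul_left L (Nat.succ_le_of_lt h2); rw [Nat.succ_eq_add_one] at this
            omega))
      (fun i h1 h2 => isFreeCell_of_le_of_le hqe' heq' (k := k)
        (by have := Nat.mul_le_mul_left L h1; rw [mul_add] at this; omega)
        (by have := Nat.mul_le_mul_left L (Nat.succ_le_of_lt h2); rw [Nat.succ_eq_add_one] at this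
            omega))
    set F := freeCount L q e m with hF
    have hq1 : (q k : ℝ) ≤ L * ((q k / L : ℕ) : ℝ) + L := by exact_mod_cast (by omega)
    have he1 : L * ((e k / L : ℕ) : ℝ) ≤ e k := by exact_mod_cast (by omega)
    have hr1 : L * ((r / L : ℕ) : ℝ) ≤ r := by exact_mod_cast (by omega)
    have hc1 : ((q k / L : ℕ) : ℝ) ≤ ((r / L : ℕ) : ℝ) + 1 + F := by exact_mod_cast (by omega)
    have hc2 : ((q k / L : ℕ) : ℝ) + m ≤ ((r / L : ℕ) : ℝ) + 1 + F + (((e k / L : ℕ) : ℝ) + 1) := by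
      exact_mod_cast (by omega)
    have hc1' := mul_le_mul_of_nonneg_left hc1 (by linarith : (0 : ℝ) ≤ L)
    have hc2' := mul_le_mul_of_nonneg_left hc2 (by linarith : (0 : ℝ) ≤ L)
    have hek := he k
    have hCL : C ≤ L * C := le_mul_of_one_le_left hC hL'
    have hθe : θ * e k ≤ (1 - 1 / D) * q k + C := by
      have := mul_le_mul_of_nonneg_left hek hθ0
      have h' : θ * C ≤ C := mul_le_of_le_one_left hC hθ1
      rw [mul_add, ← mul_assoc, hθκ] at this
      linarith
    refine le_of_mul_le_mul_left ?_ (by linarith : (0 : ℝ) < L)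
    rcases le_total ((L : ℝ) * m) (e k) with hle | hle
    · have := mul_le_mul_of_nonneg_left hle hθ0
      linarith
    · have := mul_le_mul_of_nonneg_right hθ1 (sub_nonneg.2 hle)
      linarith

end Schedule

/-! ### The mass distribution principle for codings. -/

section MassDistribution

variable {A : Type*} [TopologicalSpace A] [DiscreteTopology A]
  {X : SymbolicDynamics.FullShift.Subshift A ℕ}

/-- A mass distribution principle: `Z` contains a point `Φ c` for every sequence `c` over a finite
set `R`, and the first `n` symbols of `Φ c` determine `c` on `J n`. -/
theorem coverWeightGE_of_coding {Z : Set X.carrier} {R : Type*} [Fintype R] [Nonempty R]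
    (Φ : (ℕ → R) → X.carrier) (hΦ : ∀ c, Φ c ∈ Z) (J : ℕ → Finset ℕ)
    (hJ : ∀ n c c', Φ c' ∈ wordCylinder (Φ c) n → ∀ i ∈ J n, c' i = c i) {s : ℝ} {C : ℝ≥0∞}
    (hs : ∀ n : ℕ, C * ((Fintype.card R : ℝ≥0∞)⁻¹) ^ (J n).card ≤
      ENNReal.ofReal (Real.exp (-(s * n)))) : CoverWeightGE Z s C := by
  intro B hB hcov
  let _ : MeasurableSpace R := ⊤
  have : MeasurableSingletonClass R := ⟨fun _ => trivial⟩
  set μ := MeasureTheory.Measure.infinitePi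
    (fun _ : ℕ => (PMF.uniformOfFintype R).toMeasure) with hμ
  have hsingle : ∀ r : R, (PMF.uniformOfFintype R).toMeasure {r} = (Fintype.card R : ℝ≥0∞)⁻¹ := by
    intro r
    rw [PMF.toMeasure_apply_singleton _ _ (measurableSet_singleton r), PMF.uniformOfFintype_apply]
  -- A preimage lies in a product cylinder fixing the coordinates in `J b.2`. Only monotonicity and
  -- countable subadditivity are used, so `Φ` need not be measurable.
  have hball : ∀ b : X.carrier × ℕ, μ (Φ ⁻¹' wordCylinder b.1 b.2) ≤
      ((Fintype.card R : ℝ≥0∞)⁻¹) ^ (J b.2).card := by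
    intro b
    rcases (Φ ⁻¹' wordCylinder b.1 b.2).eq_empty_or_nonempty with he | ⟨c, hc⟩
    · simp [he]
    · have hsub : Φ ⁻¹' wordCylinder b.1 b.2 ⊆ (J b.2 : Set ℕ).pi fun i => {c i} := by
        intro c' hc' i hi
        refine hJ b.2 c c' (fun t ht => ?_) i hi
        rw [hc' t ht, hc t ht]
      refine (MeasureTheory.measure_mono hsub).trans ?_
      rw [hμ, MeasureTheory.Measure.infinitePi_pi _ (fun i _ => measurableSet_singleton _)]
      simp only [hsingle, Finset.prod_const, le_refl]
  have hone : 1 ≤ ∑' b : B, μ (Φ ⁻¹' wordCylinder b.1.1 b.1.2) := by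
    rw [← MeasureTheory.measure_univ (μ := μ)]
    have := hB.to_subtype
    refine (MeasureTheory.measure_mono ?_).trans (MeasureTheory.measure_iUnion_le _)
    intro c _
    obtain ⟨b, hb, hcb⟩ := mem_iUnion₂.1 (hcov (hΦ c))
    exact mem_iUnion.2 ⟨⟨b, hb⟩, hcb⟩
  calc C ≤ C * ∑' b : B, μ (Φ ⁻¹' wordCylinder b.1.1 b.1.2) := le_mul_of_one_le_right' hone
    _ = ∑' b : B, C * μ (Φ ⁻¹' wordCylinder b.1.1 b.1.2) := ENNReal.tsum_mul_left.symm
    _ ≤ ∑' b : B, ENNReal.ofReal (Real.exp (-(s * b.1.2))) := by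
      refine ENNReal.tsum_le_tsum fun b => le_trans ?_ (hs b.1.2)
      gcongr
      exact hball b

end MassDistribution

/-! ### Construction of a large family of points in the target set. -/

section Construction

variable {A : Type*} [TopologicalSpace A] [DiscreteTopology A]
  {X : SymbolicDynamics.FullShift.Subshift A ℕ}

/-- The segments `w k` are inserted at the times `q k`, and all the free cells of length
`M + p M` carry arbitrary segments of length `M`. -/
theorem IsGapFunction.exists_forall_apply_eq {Y : Set X.carrier} {N : ℕ} {p : ℕ → ℕ}
    (hp : IsGapFunction Y N p) {M : ℕ} (hM : 1 ≤ M) {q ℓ : ℕ → ℕ} (hℓ : ∀ k, 1 ≤ ℓ k)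
    (hq0 : M + p M ≤ q 0) (hq : ∀ k, q k + ℓ k + p (ℓ k) ≤ q (k + 1)) {w c : ℕ → X.carrier}
    (hw : ∀ k, w k ∈ Y) (hc : ∀ i, c i ∈ Y) :
    ∃ y ∈ Y, (∀ k, ∀ t < N * ℓ k, y.1 (N * q k + t) = (w k).1 t) ∧
      ∀ i, IsFreeCell (M + p M) q (fun k => q k + ℓ k + p (ℓ k)) i → ∀ t < N * M,
        y.1 (N * ((M + p M) * i) + t) = (c i).1 t := by
  set L := M + p M with hL
  have hLpos : 0 < L := by omega
  have hqm : StrictMono q := strictMono_nat_of_lt_succ fun k => by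
    have := hq k
    have := hℓ k
    omega
  set B : Set ℕ := {b | ∃ i, IsFreeCell L q (fun k => q k + ℓ k + p (ℓ k)) i ∧ L * i = b} ∪ range q
    with hB
  -- The two kinds of starting times are disjoint, so the lengths and points attached to them can be
  -- defined by `Function.extend` without conflict.
  have hfree : ∀ i, IsFreeCell L q (fun k => q k + ℓ k + p (ℓ k)) i → L * i ∉ range q := by
    rintro i hi ⟨k, hk⟩
    have := hℓ k
    rcases hi k with h | h
    · rw [hk, mul_add] at h
      omega
    · simp only at h
      omega
  have hfree' : ∀ i, IsFreeCell L q (fun k => q k + ℓ k + p (ℓ k)) i → ¬∃ k, q k = L * i := hfree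
  set len : ℕ → ℕ := Function.extend q ℓ (fun _ => M) with hlen
  set pt : ℕ → X.carrier := Function.extend q w (fun b => c (b / L)) with hpt
  have hlenq : ∀ k, len (q k) = ℓ k := fun k => hqm.injective.extend_apply _ _ _
  have hptq : ∀ k, pt (q k) = w k := fun k => hqm.injective.extend_apply _ _ _
  have hlenL : ∀ i, IsFreeCell L q (fun k => q k + ℓ k + p (ℓ k)) i → len (L * i) = M :=
    fun i hi => Function.extend_apply' _ _ _ (hfree' i hi)
  have hptL : ∀ i, IsFreeCell L q (fun k => q k + ℓ k + p (ℓ k)) i → pt (L * i) = c i := by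
    intro i hi
    rw [hpt, Function.extend_apply' _ _ _ (hfree' i hi), Nat.mul_div_cancel_left _ hLpos]
  have hBinf : B.Infinite := (infinite_range_of_injective hqm.injective).mono subset_union_right
  have hB0 : 0 ∈ B := by
    refine Or.inl ⟨0, fun k => Or.inl ?_, by simp⟩
    simpa using hq0.trans (hqm.monotone (Nat.zero_le k))
  have hBY : ∀ b ∈ B, pt b ∈ Y := by
    rintro _ (⟨i, hi, rfl⟩ | ⟨k, rfl⟩)
    · rw [hptL i hi]
      exact hc i
    · rw [hptq]
      exact hw k
  have hBlen : ∀ b ∈ B, 1 ≤ len b := by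
    rintro _ (⟨i, hi, rfl⟩ | ⟨k, rfl⟩)
    · rwa [hlenL i hi]
    · rw [hlenq]
      exact hℓ k
  obtain ⟨y, hy, hyB⟩ := hp B len pt hBinf hB0 hBY hBlen (by
    rintro _ (⟨i, hi, rfl⟩ | ⟨k, rfl⟩) _ (⟨i', hi', rfl⟩ | ⟨k', rfl⟩) hlt
    · rw [hlenL i hi]
      have h1 : i + 1 ≤ i' := lt_of_mul_lt_mul_left hlt (Nat.zero_le L)
      have h2 := Nat.mul_le_mul_left L h1
      rw [mul_add] at h2
      omega
    · rw [hlenL i hi]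
      rcases hi k' with h | h
      · rw [mul_add] at h
        omega
      · simp only at h
        omega
    · rw [hlenq]
      rcases hi' k with h | h
      · rw [mul_add] at h
        omega
      · exact h
    · rw [hlenq]
      exact (hq k).trans (hqm.monotone (hqm.lt_iff_lt.1 hlt)))
  refine ⟨y, hy, fun k t ht => ?_, fun i hi t ht => ?_⟩
  · rw [hyB (q k) (Or.inr ⟨k, rfl⟩) t (by rwa [hlenq]), hptq]
  · rw [hyB (L * i) (Or.inl ⟨i, hi, rfl⟩) t (by rwa [hlenL i hi]), hptL i hi]

/-- `z` is the image under `f^I`, `I < N`, of a point `w` of `Y`, and `n + a` is `I` modulo `N`. -/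
def IsAlignedTime (Y : Set X.carrier) (N a : ℕ) (z : X.carrier) (n : ℕ) : Prop :=
  ∃ w ∈ Y, ∃ I < N, ∃ q, (subshiftMap X)^[I] w = z ∧ n + a = I + N * q

theorem exists_targetSet_coding {Y : Set X.carrier} {N : ℕ} {p : ℕ → ℕ}
    (hp : IsGapFunction Y N p) {a : ℕ} (ha : a < N) {φ : ℕ → ℕ → ℝ} (hφ : ∀ j n, 0 < φ j n)
    {z : ℕ → ℕ → X.carrier} {S : ℕ → Set ℕ} {Q : ℕ → ℕ → Prop}
    (hT : ∀ j, ∃ᶠ n in atTop, n ∈ S j ∧ IsAlignedTime Y N a (z j n) n ∧ Q j n)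
    {M D : ℕ} (hM : 1 ≤ M) (hD : 1 ≤ D) :
    ∃ q ℓ : ℕ → ℕ, (∀ k, 1 ≤ ℓ k) ∧ (∀ k, D * (q k + ℓ k + p (ℓ k)) ≤ q (k + 1)) ∧
      (∀ k, ∃ j n, Q j n ∧ n ≤ N * (q k + 1) ∧ ℓ k = ⌈-Real.log (φ j n) / N⌉₊ + 1) ∧
      ∀ c : ℕ → X.carrier, (∀ i, c i ∈ Y) → ∃ y ∈ Y,
        (subshiftMap X)^[a] y ∈ ⋂ j, targetSet (subshiftMap X) (φ j) (z j) (S j) ∧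
        ∀ i, IsFreeCell (M + p M) q (fun k => q k + ℓ k + p (ℓ k)) i → ∀ t < N * M,
          y.1 (N * ((M + p M) * i) + t) = (c i).1 t := by
  have hN : 0 < N := by omega
  -- Slot `k` serves the index `(Nat.unpair k).1`, so every `j` is served infinitely often. In the
  -- length, the ceiling gives accuracy `φ`, and the extra `1` makes room for the offset `I < N` at
  -- which `z` begins inside the segment of `w`.
  obtain ⟨q, ℓ, hP, hq0, hq⟩ := exists_sparse_schedule
    (P := fun k q ℓ => ∃ n ∈ S (Nat.unpair k).1, Q (Nat.unpair k).1 n ∧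
      ℓ = ⌈-Real.log (φ (Nat.unpair k).1 n) / N⌉₊ + 1 ∧ ∃ w ∈ Y, ∃ I < N,
        (subshiftMap X)^[I] w = z (Nat.unpair k).1 n ∧ n + a = I + N * q) (by
      intro k b
      obtain ⟨n, ⟨hnS, ⟨w, hw, I, hI, q, hwz, hnq⟩, hQ⟩, hnb⟩ :=
        ((hT (Nat.unpair k).1).and_eventually (eventually_ge_atTop (N * (b + 1)))).exists
      refine ⟨q, _, ?_, n, hnS, hQ, rfl, w, hw, I, hI, hwz, hnq⟩
      by_contra! hlt
      have := Nat.mul_le_mul_left N (Nat.succ_le_of_lt hlt)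
      rw [Nat.succ_eq_add_one] at this
      rw [mul_add] at this hnb
      omega) p (M + p M) D
  choose n hnS hQ hℓ w hw I hI hwz hnq using hP
  have hℓ1 : ∀ k, 1 ≤ ℓ k := fun k => by rw [hℓ]; omega
  have hq' : ∀ k, q k + ℓ k + p (ℓ k) ≤ q (k + 1) := fun k =>
    (Nat.le_mul_of_pos_left _ hD).trans (hq k)
  have hqm : StrictMono q := strictMono_nat_of_lt_succ fun k => by
    have := hq' k
    have := hℓ1 k
    omega
  refine ⟨q, ℓ, hℓ1, hq, fun k => ⟨_, n k, hQ k, ?_, hℓ k⟩, fun c hc => ?_⟩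
  · have := hnq k
    have := hI k
    rw [mul_add]
    omega
  obtain ⟨y, hy, hyw, hyc⟩ := hp.exists_forall_apply_eq hM hℓ1 hq0 hq' hw hc
  refine ⟨y, hy, mem_iInter.2 fun j => infinite_of_forall_exists_gt fun b => ?_, hyc⟩
  -- The slot index exceeds `b`, and `q k ≥ k`; since `a < N`, the hitting time `n k = I + N q - a`
  -- then exceeds `b`.
  set k := Nat.pair j (b + 1) with hk
  have hkj : (Nat.unpair k).1 = j := by simp [hk]
  refine ⟨n k, ⟨hkj ▸ hnS k, ?_⟩, ?_⟩
  · rw [← hkj, ← hwz k, dist_comm]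
    have hle : Real.exp (-((N * (ℓ k - 1) : ℕ) : ℝ)) ≤ φ (Nat.unpair k).1 (n k) := by
      rw [← Real.le_log_iff_exp_le (hφ _ _), hℓ k, Nat.add_sub_cancel]
      have h1 := Nat.le_ceil (-Real.log (φ (Nat.unpair k).1 (n k)) / N)
      rw [div_le_iff₀ (by exact_mod_cast hN)] at h1
      push_cast
      linarith
    refine lt_of_lt_of_le ((dist_lt_exp_neg_iff _ _ _).2 fun i hi => ?_) hle
    simp only [subshiftMap_iterate_apply]
    have h1 := hI k
    have h2 := hnq k
    have h3 : N * ℓ k = N * (ℓ k - 1) + N := by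
      obtain ⟨r, hr⟩ := Nat.exists_eq_add_of_le' (hℓ1 k)
      rw [hr, Nat.add_sub_cancel, mul_add, mul_one]
    rw [← hyw k (I k + i) (by omega)]
    exact congrArg y.1 (by omega)
  · have h1 : b + 1 ≤ k := Nat.right_le_pair j (b + 1)
    have h2 : k ≤ q k := hqm.le_apply
    have h3 := hnq k
    have h4 : N * (b + 1) ≤ N * q k := Nat.mul_le_mul_left N (h1.trans h2)
    have h5 : b ≤ N * b := Nat.le_mul_of_pos_left _ hN
    rw [mul_add] at h4
    omega

theorem iInter_targetSet_nonempty {Y : Set X.carrier} (hYne : Y.Nonempty) {N : ℕ} {p : ℕ → ℕ}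
    (hp : IsGapFunction Y N p) {a : ℕ} (ha : a < N) {φ : ℕ → ℕ → ℝ} (hφ : ∀ j n, 0 < φ j n)
    {z : ℕ → ℕ → X.carrier} {S : ℕ → Set ℕ}
    (hT : ∀ j, ∃ᶠ n in atTop, n ∈ S j ∧ IsAlignedTime Y N a (z j n) n) :
    (⋂ j, targetSet (subshiftMap X) (φ j) (z j) (S j)).Nonempty := by
  obtain ⟨x, hx⟩ := hYne
  obtain ⟨_, _, _, _, _, h⟩ := exists_targetSet_coding hp ha hφ (Q := fun _ _ => True)
    (S := S) (z := z) (by simpa using hT) le_rfl le_rfl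
  obtain ⟨y, -, hy, -⟩ := h (fun _ => x) (fun _ => hx)
  exact ⟨_, hy⟩

theorem exists_le_mul_add_of_tendsto_div {p : ℕ → ℕ}
    (hp : Tendsto (fun n : ℕ => (p n : ℝ) / n) atTop (𝓝 0)) {δ : ℝ} (hδ : 0 < δ) :
    ∃ C : ℝ, 0 ≤ C ∧ ∀ n, (p n : ℝ) ≤ δ * n + C := by
  obtain ⟨n₀, hn₀⟩ := eventually_atTop.1 ((tendsto_order.1 hp).2 δ hδ)
  refine ⟨∑ n ∈ Finset.range (n₀ + 1), (p n : ℝ), by positivity, fun n => ?_⟩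
  rcases lt_or_ge n (n₀ + 1) with hn | hn
  · have := Finset.single_le_sum (f := fun n => (p n : ℝ)) (fun _ _ => Nat.cast_nonneg _)
      (Finset.mem_range.2 hn)
    have h2 : 0 ≤ δ * n := by positivity
    linarith
  · have h1 := hn₀ n (by omega)
    rw [div_lt_iff₀ (by exact_mod_cast (by omega : 0 < n))] at h1
    have : (0 : ℝ) ≤ ∑ n ∈ Finset.range (n₀ + 1), (p n : ℝ) := by positivity
    linarith

theorem exists_natCast_lt_mul_div {s h : ℝ} (hsh : s < h) :
    ∃ D : ℕ, 2 ≤ D ∧ s < h * ((1 - 1 / D) / ((1 + 1 / D) * (1 + 1 / D))) := by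
  have h1 : Tendsto (fun D : ℕ => h * ((1 - 1 / (D : ℝ)) / ((1 + 1 / D) * (1 + 1 / D)))) atTop
      (𝓝 (h * ((1 - 0) / ((1 + 0) * (1 + 0))))) := by
    have h0 : Tendsto (fun D : ℕ => 1 / (D : ℝ)) atTop (𝓝 0) := tendsto_one_div_atTop_nhds_zero_nat
    exact ((h0.const_sub 1).div ((h0.const_add 1).mul (h0.const_add 1)) (by norm_num)).const_mul h
  obtain ⟨D, hD, hD2⟩ := (((tendsto_order.1 h1).1 s (by simpa using hsh)).and
    (eventually_ge_atTop 2)).exists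
  exact ⟨D, hD2, hD⟩

theorem exists_coverWeightGE_iInter_targetSet [Finite A] {Y : Set X.carrier}
    {N : ℕ} (hXY : ⋃ l ∈ Finset.range N, (subshiftMap X)^[l] '' Y = univ) {p : ℕ → ℕ}
    (hp : IsGapFunction Y N p)
    (hp0 : Tendsto (fun n : ℕ => (p n : ℝ) / n) atTop (𝓝 0))
    {a : ℕ} (ha : a < N) {φ : ℕ → ℕ → ℝ} (hφ : ∀ j n, 0 < φ j n)
    {z : ℕ → ℕ → X.carrier} {S : ℕ → Set ℕ} {τ s : ℝ} (hτ : 0 ≤ τ) (hs : 0 ≤ s)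
    (hT : ∀ j, ∃ᶠ n : ℕ in atTop, n ∈ S j ∧ IsAlignedTime Y N a (z j n) n ∧
      -Real.log (φ j n) ≤ τ * n)
    (h : ENNReal.ofReal (s * (1 + τ)) < topEntropy (subshiftMap X)) :
    ∃ C : ℝ≥0∞, C ≠ 0 ∧
      CoverWeightGE (⋂ j, targetSet (subshiftMap X) (φ j) (z j) (S j)) s C := by
  have hN : 0 < N := by omega
  have hN' : (0 : ℝ) < N := by exact_mod_cast hN
  obtain ⟨H, hsH, hH⟩ := ENNReal.lt_iff_exists_nnreal_btwn.1 h
  rw [← ENNReal.ofReal_coe_nnreal] at hsH hH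
  rw [ENNReal.ofReal_lt_ofReal_iff_of_nonneg (by positivity)] at hsH
  -- Three losses must fit between `s (1 + τ)` and `H`: the factor `1 - 1 / D` from earlier targets,
  -- one `1 + 1 / D` from the gaps after target segments, and another from the gaps inside free
  -- cells.
  obtain ⟨D, hD2, hD⟩ := exists_natCast_lt_mul_div hsH
  have hDpos : (0 : ℝ) < 1 / D := by positivity
  obtain ⟨Cp, hCp0, hCp⟩ := exists_le_mul_add_of_tendsto_div hp0 hDpos
  obtain ⟨M, hMw, hMp, hM1⟩ := ((frequently_exp_le_wordCount_of_iUnion_eq hN hXY H.coe_nonneg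
    hH).and_eventually (((tendsto_order.1 hp0).2 _ hDpos).and (eventually_ge_atTop 1))).exists
  have hM0 : (0 : ℝ) < M := by exact_mod_cast hM1
  rw [div_lt_iff₀ hM0] at hMp
  set L := M + p M with hL
  have hLpos : 0 < L := by omega
  obtain ⟨q, ℓ, hℓ1, hq, hrate, hcode⟩ := exists_targetSet_coding hp ha hφ hT hM1
    (show 1 ≤ D by omega)
  set e : ℕ → ℕ := fun k => q k + ℓ k + p (ℓ k) with he
  set κ : ℝ := (1 + 1 / D) * (1 + τ) with hκ
  set C₁ : ℝ := (1 + 1 / D) * (τ + 2) + Cp with hC₁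
  have hκ1 : 1 ≤ κ := by
    rw [hκ]
    nlinarith
  have hek : ∀ k, (e k : ℝ) ≤ κ * q k + C₁ := by
    intro k
    obtain ⟨j, n, hjn, hn, hℓk⟩ := hrate k
    have h1 : (ℓ k : ℝ) ≤ τ * (q k + 1) + 2 := by
      have hnr : (n : ℝ) ≤ N * (q k + 1) := by exact_mod_cast hn
      have h2 : -Real.log (φ j n) / N ≤ τ * (q k + 1) := by
        rw [div_le_iff₀ hN']
        nlinarith
      have h3 : (⌈-Real.log (φ j n) / N⌉₊ : ℝ) ≤ τ * (q k + 1) + 1 :=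
        (Nat.cast_le.2 (Nat.ceil_mono h2)).trans (Nat.ceil_lt_add_one (by positivity)).le
      rw [hℓk]
      push_cast
      linarith
    have h2 := hCp (ℓ k)
    have h3 : (0 : ℝ) ≤ 1 / D * q k := by positivity
    have h4 := mul_le_mul_of_nonneg_left h1 (by positivity : 0 ≤ 1 + 1 / (D : ℝ))
    simp only [he, hκ, hC₁]
    push_cast
    nlinarith
  have hcount := mul_le_freeCount_add (L := L) (D := D) (q := q) (e := e) hLpos (by omega)
    (fun k => by have := hℓ1 k; simp only [he]; omega) hq hκ1 (by positivity) hek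
  set θ : ℝ := (1 - 1 / D) / κ with hθ
  obtain ⟨R, hRY, hRfin, hRcard, hRinj, -⟩ := exists_representatives Y (N * M)
  have hRfintype : Fintype R := hRfin.fintype
  have hRexp : Real.exp (H * (N * M : ℕ)) ≤ Fintype.card R := by
    rw [← Nat.card_eq_fintype_card, Nat.card_coe_set_eq, hRcard]
    exact hMw
  have hRne : Nonempty R := by
    rw [← Fintype.card_pos_iff]
    exact_mod_cast (Real.exp_pos _).trans_le hRexp
  choose y hyY hyT hyc using fun c : ℕ → R => hcode (fun i => (c i).1) (fun i => hRY (c i).2)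
  classical
  -- Cell `0` is dropped because passing from `y` to `f^a y` loses the first `a < N` symbols; every
  -- later cell remains visible.
  set J : ℕ → Finset ℕ := fun n =>
    ((Finset.range (n / (N * L))).filter (IsFreeCell L q e)).erase 0 with hJ
  -- Collects all bounded errors: rounding `n` to cells, the additive error in the free count, and
  -- the dropped cell.
  set K : ℝ := H * (N * M) * (θ + (3 + C₁) + 1) with hK
  refine ⟨ENNReal.ofReal (Real.exp (-K)), by simp [Real.exp_pos], coverWeightGE_of_coding
    (fun c => (subshiftMap X)^[a] (y c)) hyT J ?_ ?_⟩
  · intro n c c' hcc i hi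
    simp only [hJ, Finset.mem_erase, Finset.mem_filter, Finset.mem_range] at hi
    obtain ⟨hi0, hin, hifree⟩ := hi
    refine Subtype.ext (hRinj (c' i).2 (c i).2 (initialWord_eq_iff.2 fun t ht => ?_))
    rw [← hyc c i hifree t ht, ← hyc c' i hifree t ht]
    have h1 : N ≤ N * (L * i) := Nat.le_mul_of_pos_right _ (Nat.mul_pos hLpos (by omega))
    have h2 : N * (L * i) + t < n := by
      have h3 := Nat.mul_le_mul_left (N * L) (Nat.succ_le_of_lt hin)
      have h4 := Nat.mul_div_le n (N * L)
      have h5 : N * M ≤ N * L := Nat.mul_le_mul_left N (by omega)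
      rw [Nat.succ_eq_add_one, mul_add, mul_one, mul_assoc] at h3
      omega
    have h6 := hcc (N * (L * i) + t - a) (by omega)
    simp only [subshiftMap_iterate_apply] at h6
    rwa [show a + (N * (L * i) + t - a) = N * (L * i) + t by omega] at h6
  · intro n
    have hJcard : freeCount L q e (n / (N * L)) ≤ (J n).card + 1 := by
      have := Finset.pred_card_le_card_erase (a := 0)
        (s := (Finset.range (n / (N * L))).filter (IsFreeCell L q e))
      simp only [hJ, freeCount]
      omega
    have hJr : (freeCount L q e (n / (N * L)) : ℝ) ≤ (J n).card + 1 := by exact_mod_cast hJcard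
    have hθ0 : 0 ≤ θ := by
      refine div_nonneg ?_ (by linarith)
      have : (1 : ℝ) ≤ D := by exact_mod_cast (by omega : 1 ≤ D)
      rw [sub_nonneg, div_le_one (by linarith)]
      exact this
    have hL' : (0 : ℝ) < L := by exact_mod_cast hLpos
    have hdiv : (n : ℝ) / (N * L) ≤ ((n / (N * L) : ℕ) : ℝ) + 1 := by
      rw [div_le_iff₀ (by positivity)]
      exact_mod_cast (Nat.lt_mul_div_succ n (Nat.mul_pos hN hLpos)).le.trans_eq (mul_comm _ _)
    have hlow : θ * (n / (N * L)) - (θ + (3 + C₁) + 1) ≤ (J n).card := by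
      have := hcount (n / (N * L))
      have := mul_le_mul_of_nonneg_left hdiv hθ0
      linarith
    have hsn : s * n ≤ H * (N * M) * (θ * (n / (N * L))) := by
      have h1 : (L : ℝ) ≤ (1 + 1 / D) * M := by
        rw [hL]
        push_cast
        linarith
      have h2 : s ≤ H * θ / (1 + 1 / D) := by
        have h6 : H * θ / (1 + 1 / D) =
            H * ((1 - 1 / D) / ((1 + 1 / D) * (1 + 1 / D))) / (1 + τ) := by
          rw [hθ, hκ, div_mul_eq_div_div_swap, div_mul_eq_div_div]
          ring
        rw [h6, le_div_iff₀ (by positivity)]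
        exact hD.le
      have h3 : H * (N * M) * (θ * (n / (N * L))) = H * θ * n * (M / L) := by
        field_simp
      have h4 : 1 / (1 + 1 / (D : ℝ)) ≤ M / L := by
        rw [div_le_div_iff₀ (by positivity) hL']
        linarith
      have h5 : 0 ≤ (H : ℝ) * θ * n := by positivity
      rw [h3]
      calc s * n ≤ H * θ / (1 + 1 / D) * n := by gcongr
        _ = H * θ * n * (1 / (1 + 1 / D)) := by ring
        _ ≤ _ := mul_le_mul_of_nonneg_left h4 h5
    have hpow : Real.exp (s * n - K) ≤ (Fintype.card R : ℝ) ^ (J n).card := by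
      refine le_trans ?_ (pow_le_pow_left₀ (Real.exp_pos _).le hRexp _)
      rw [← Real.exp_nat_mul]
      refine Real.exp_le_exp.2 ?_
      have h0 : (0 : ℝ) ≤ H * (N * M) := by positivity
      have := mul_le_mul_of_nonneg_left hlow h0
      rw [hK]
      push_cast
      linarith
    have hcardpos : (0 : ℝ) < (Fintype.card R : ℝ) ^ (J n).card := (Real.exp_pos _).trans_le hpow
    have hreal : Real.exp (-K) * ((Fintype.card R : ℝ) ^ (J n).card)⁻¹ ≤ Real.exp (-(s * n)) := by
      rw [← div_eq_mul_inv, div_le_iff₀ hcardpos]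
      refine le_trans (le_of_eq ?_) (mul_le_mul_of_nonneg_left hpow (Real.exp_pos _).le)
      rw [← Real.exp_add]
      congr 1
      ring
    refine le_trans (le_of_eq ?_) (ENNReal.ofReal_le_ofReal hreal)
    rw [ENNReal.ofReal_mul (Real.exp_pos _).le, ENNReal.ofReal_inv_of_pos hcardpos,
      ENNReal.ofReal_pow (Nat.cast_nonneg _), ENNReal.ofReal_natCast, ENNReal.inv_pow]

end Construction

/-! ### Lower bounds in terms of decay rates. -/

section LowerBound

variable {A : Type*} [TopologicalSpace A] [DiscreteTopology A]
  {X : SymbolicDynamics.FullShift.Subshift A ℕ}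

theorem exists_coverWeightGE_of_lt [Finite A] {Y : Set X.carrier}
    {N : ℕ} (hXY : ⋃ l ∈ Finset.range N, (subshiftMap X)^[l] '' Y = univ) {p : ℕ → ℕ}
    (hp : IsGapFunction Y N p) (hp0 : Tendsto (fun n : ℕ => (p n : ℝ) / n) atTop (𝓝 0))
    {a : ℕ} (ha : a < N) {φ : ℕ → ℕ → ℝ} (hφ : ∀ j n, 0 < φ j n)
    {z : ℕ → ℕ → X.carrier} {S : ℕ → Set ℕ} {U : ℝ≥0∞}
    (hT : ∀ τ : ℝ≥0, U < τ → ∀ j, ∃ᶠ n : ℕ in atTop, n ∈ S j ∧ IsAlignedTime Y N a (z j n) n ∧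
      -Real.log (φ j n) ≤ τ * n) {s : ℝ≥0}
    (hs : s < (1 + U)⁻¹ * topEntropy (subshiftMap X)) :
    ∃ C : ℝ≥0∞, C ≠ 0 ∧
      CoverWeightGE (⋂ j, targetSet (subshiftMap X) (φ j) (z j) (S j)) s C := by
  have hU : U ≠ ∞ := by
    rintro rfl
    simp at hs
  lift U to ℝ≥0 using hU
  obtain ⟨h, hh⟩ : ∃ h : ℝ≥0, topEntropy (subshiftMap X) = h :=
    ⟨_, (ENNReal.coe_toNNReal topEntropy_ne_top).symm⟩
  rw [hh, mul_comm, ← div_eq_mul_inv, ENNReal.lt_div_iff_mul_lt (Or.inl (by simp))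
    (Or.inl (by simp))] at hs
  have hs' : (s : ℝ) * (1 + U) < h := by exact_mod_cast hs
  have hs0 : (0 : ℝ) ≤ s := s.coe_nonneg
  -- Slack chosen so that `s (1 + U + g) < h`; the denominator `s + 1` also covers `s = 0`.
  set g : ℝ := (h - s * (1 + U)) / (s + 1) with hg
  have hgpos : 0 < g := div_pos (by linarith) (by linarith)
  have hgs : g * (s + 1) = h - s * (1 + U) := div_mul_cancel₀ _ (by linarith)
  set τ : ℝ≥0 := U + ⟨g, hgpos.le⟩ with hτ
  have hτr : (τ : ℝ) = U + g := rfl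
  refine exists_coverWeightGE_iInter_targetSet hXY hp hp0 ha hφ (τ := τ) τ.coe_nonneg hs0
    (hT τ ?_) ?_
  · have : U < τ := by
      rw [← NNReal.coe_lt_coe, hτr]
      linarith
    exact_mod_cast this
  · rw [hh, ← ENNReal.ofReal_coe_nnreal,
      ENNReal.ofReal_lt_ofReal_iff_of_nonneg (by positivity), hτr]
    nlinarith

/-- If `s i ≡ I₂` and `a ≡ I₁ - I₂` modulo `N`, then `s i + a ≡ I₁`. The shift `a` depends on `d`
alone, not on the sequence, so one shift works for all `j`. -/
theorem frequently_and_aligned {Y : Set X.carrier} {N : ℕ} (hN : 0 < N) {z : ℕ → X.carrier}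
    {s : ℕ → ℕ} (hs : Tendsto s atTop atTop) {d : ℤ} (hd : d ∈ IndDiff (subshiftMap X) N Y z s) :
    ∃ᶠ n in atTop, n ∈ range s ∧ IsAlignedTime Y N (d % N).toNat (z n) n := by
  obtain ⟨⟨I₁, I₂⟩, ⟨hI₁, hI₂, hinf⟩, rfl⟩ := hd
  refine hs.frequently (((Nat.frequently_atTop_iff_infinite.2 hinf).and_eventually
    (hs.eventually_ge_atTop N)).mono ?_)
  rintro i ⟨⟨⟨w, hw, hwz⟩, hdvd⟩, hNi⟩
  refine ⟨mem_range_self i, w, hw, I₁, hI₁, ?_⟩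
  simp only at hI₁ hI₂ hwz hdvd ⊢
  set a : ℕ := (((I₁ : ℤ) - I₂) % N).toNat with ha
  have haz : (a : ℤ) = ((I₁ : ℤ) - I₂) % N :=
    Int.toNat_of_nonneg (Int.emod_nonneg _ (by omega))
  have hdvd' : (N : ℤ) ∣ ((s i + a - I₁ : ℕ) : ℤ) := by
    have h1 : (N : ℤ) ∣ ((I₁ : ℤ) - I₂) - a := by
      rw [haz]
      exact Int.dvd_self_sub_emod
    have h2 : ((s i + a - I₁ : ℕ) : ℤ) = ((s i : ℤ) - I₂) - ((I₁ : ℤ) - I₂ - a) := by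
      rw [Nat.cast_sub (by omega)]
      push_cast
      ring
    rw [h2]
    exact dvd_sub hdvd h1
  obtain ⟨q, hq⟩ := Int.natCast_dvd_natCast.1 hdvd'
  exact ⟨q, hwz, by omega⟩

theorem eventually_neg_log_le_of_upperRate_lt {φ : ℕ → ℝ} {τ : ℝ≥0} (h : upperRate φ < τ) :
    ∀ᶠ n : ℕ in atTop, -Real.log (φ n) ≤ τ * n := by
  filter_upwards [eventually_lt_of_limsup_lt h, eventually_gt_atTop 0] with n hn hn0
  rw [← ENNReal.ofReal_coe_nnreal] at hn
  have h1 := (ENNReal.ofReal_lt_ofReal_iff'.1 hn).1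
  rw [div_lt_iff₀ (by exact_mod_cast hn0)] at h1
  exact h1.le

theorem frequently_neg_log_le_of_lowerRate_lt {φ : ℕ → ℝ} {τ : ℝ≥0} (h : lowerRate φ < τ) :
    ∃ᶠ n : ℕ in atTop, -Real.log (φ n) ≤ τ * n := by
  refine ((frequently_lt_of_liminf_lt (by isBoundedDefault) h).and_eventually
    (eventually_gt_atTop 0)).mono fun n ⟨hn, hn0⟩ => ?_
  rw [← ENNReal.ofReal_coe_nnreal] at hn
  have h1 := (ENNReal.ofReal_lt_ofReal_iff'.1 hn).1
  rw [div_lt_iff₀ (by exact_mod_cast hn0)] at h1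
  exact h1.le

theorem le_bowenEntropy_and_le_dimH {Z : Set X.carrier} {b : ℝ≥0∞}
    (h : ∀ s : ℝ≥0, s < b → ∃ C : ℝ≥0∞, C ≠ 0 ∧ CoverWeightGE Z s C) :
    b ≤ bowenEntropy (subshiftMap X) Z ∧ b ≤ dimH Z := by
  constructor <;> refine ENNReal.le_of_forall_nnreal_lt fun s hs => ?_
  · obtain ⟨C, hC, hw⟩ := h s hs
    exact le_bowenEntropy_of_coverWeightGE hC hw
  · rcases eq_or_ne s 0 with rfl | hs0
    · simp
    · obtain ⟨C, hC, hw⟩ := h s hs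
      exact le_dimH_of_coverWeightGE (pos_iff_ne_zero.2 hs0) hC hw

end LowerBound

end ShrinkingTarget


/-! ### Conclusion. -/

theorem theorem1p19 {A : Type*} [Finite A] [TopologicalSpace A] [DiscreteTopology A]
    (X : SymbolicDynamics.FullShift.Subshift A ℕ)
    (Y : Set X.carrier) (N : ℕ) (hN : 0 < N)
    (hYne : Y.Nonempty) (hYc : IsCompact Y)
    (hYN : (subshiftMap X)^[N] '' Y = Y)
    (hXY : ⋃ l ∈ Finset.range N, (subshiftMap X)^[l] '' Y = Set.univ)
    (hspec : NonuniformSpecification ((subshiftMap X)^[N]) Y)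
    (φ : ℕ → ℕ → ℝ) (hφ : ∀ j n, φ j n ∈ Set.Ioc (0 : ℝ) 1)
    (z : ℕ → ℕ → X.carrier)
    (s : ℕ → ℕ → ℕ) (hs : ∀ j, Filter.Tendsto (s j) Filter.atTop Filter.atTop)
    (hInd : (⋂ j, IndDiff (subshiftMap X) N Y (z j) (s j)).Nonempty) :
    -- the intersection of the shrinking target sets is non-empty
    (⋂ j, targetSet (subshiftMap X) (φ j) (z j) (Set.range (s j))).Nonempty ∧
    -- bounds for the entropy
    (1 + ⨆ j, upperRate (φ j))⁻¹ * topEntropy (subshiftMap X) ≤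
      bowenEntropy (subshiftMap X)
        (⋂ j, targetSet (subshiftMap X) (φ j) (z j) (Set.range (s j))) ∧
    bowenEntropy (subshiftMap X)
        (⋂ j, targetSet (subshiftMap X) (φ j) (z j) (Set.range (s j))) ≤
      (1 + ⨆ j, lowerRate (φ j))⁻¹ * topEntropy (subshiftMap X) ∧
    -- bounds for the Hausdorff dimension
    (1 + ⨆ j, upperRate (φ j))⁻¹ * topEntropy (subshiftMap X) ≤
      dimH (⋂ j, targetSet (subshiftMap X) (φ j) (z j) (Set.range (s j))) ∧
    dimH (⋂ j, targetSet (subshiftMap X) (φ j) (z j) (Set.range (s j))) ≤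
      (1 + ⨆ j, lowerRate (φ j))⁻¹ * topEntropy (subshiftMap X) ∧
    -- equalities when `Y = X`, `N = 1` and every `S_j` is the set of all (positive) integers
    (Y = Set.univ → N = 1 → (∀ j n, 1 ≤ n → n ∈ Set.range (s j)) →
      bowenEntropy (subshiftMap X)
          (⋂ j, targetSet (subshiftMap X) (φ j) (z j) (Set.range (s j))) =
        (1 + ⨆ j, lowerRate (φ j))⁻¹ * topEntropy (subshiftMap X) ∧
      dimH (⋂ j, targetSet (subshiftMap X) (φ j) (z j) (Set.range (s j))) =
        (1 + ⨆ j, lowerRate (φ j))⁻¹ * topEntropy (subshiftMap X)) := by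

  obtain ⟨p, hp0, hp⟩ := hspec.exists_isGapFunction hYc hN
  obtain ⟨d, hd⟩ := hInd
  have hφ0 : ∀ j n, 0 < φ j n := fun j n => (hφ j n).1
  have ha : (d % N).toNat < N := by
    have := Int.emod_lt_of_pos d (by exact_mod_cast hN : (0 : ℤ) < N)
    have := Int.emod_nonneg d (by omega : (N : ℤ) ≠ 0)
    omega
  have hT := fun j => frequently_and_aligned hN (hs j) (Set.mem_iInter.1 hd j)
  have hlow := le_bowenEntropy_and_le_dimH (X := X)
    (Z := ⋂ j, targetSet (subshiftMap X) (φ j) (z j) (Set.range (s j)))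
    (b := (1 + ⨆ j, upperRate (φ j))⁻¹ * topEntropy (subshiftMap X)) fun t ht =>
      exists_coverWeightGE_of_lt hXY hp hp0 ha hφ0 (fun τ hτ j =>
        ((hT j).and_eventually (eventually_neg_log_le_of_upperRate_lt
          ((le_iSup _ j).trans_lt hτ))).mono fun n hn => ⟨hn.1.1, hn.1.2, hn.2⟩) ht
  have hup₁ := bowenEntropy_iInter_targetSet_le hφ z (fun j => Set.range (s j))
  have hup₂ := dimH_iInter_targetSet_le hφ z (fun j => Set.range (s j))
  refine ⟨iInter_targetSet_nonempty hYne hp ha hφ0 hT, hlow.1, hup₁, hlow.2, hup₂, ?_⟩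
  rintro rfl rfl hS
  have hlow' := le_bowenEntropy_and_le_dimH (X := X)
    (Z := ⋂ j, targetSet (subshiftMap X) (φ j) (z j) (Set.range (s j)))
    (b := (1 + ⨆ j, lowerRate (φ j))⁻¹ * topEntropy (subshiftMap X)) fun t ht =>
      -- With `N = 1` and `Y` everything, each time is aligned with `w = z j n` and `I = 0`, so the
      -- times at which `φ j` decays slowly can be used.
      exists_coverWeightGE_of_lt hXY hp hp0 (a := 0) one_pos hφ0 (fun τ hτ j =>
        ((frequently_neg_log_le_of_lowerRate_lt ((le_iSup _ j).trans_lt hτ)).and_eventually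
          (Filter.eventually_ge_atTop 1)).mono fun n hn =>
            ⟨hS j n hn.2, ⟨z j n, Set.mem_univ _, 0, one_pos, n, rfl, by omega⟩, hn.1⟩) ht
  exact ⟨le_antisymm hup₁ hlow'.1, le_antisymm hup₂ hlow'.2⟩
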